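/- **Discrete embedding type convolution inequality.** *Space.* Let $L>0$, let $M$ be a positive even integer, $h=L/M$, $\nu=2\pi/L$, and let $\mathbb V_h$ be the space of real functions on the grid $\Omega_h=\{(ih,jh):0\le i,j\le M-1\}$, with $\langle v,w\rangle=h^2\sum_{\Omega_h}v_hw_h$, $\|v\|=\langle v,v\rangle^{1/2}$, $\|v\|_{l^q}=(h^2\sum_{\Omega_h}|v_h|^q)^{1/q}$, and $\mathring{\mathbb V}_h=\{v\in\mathbb V_h:\langle v,1\rangle=0\}$. Let $\widetilde v_{m,n}$ $(-M/2\le m,n\le M/2-1)$ be the discrete Fourier coefficients of $v$, so that $v_h=\sum_{m,n}\widetilde v_{m,n}e^{\mathrm i\nu(mx+ny)}$ on $\Omega_h$. Put $\lambda_{m,n}=\nu^2(m^2+n^2)$ and $$(-\Delta_h)^{\gamma}v_h=\sum_{(m,n)\ne0}\lambda_{m,n}^{\gamma}\widetilde v_{m,n}e^{\mathrm i\nu(mx+ny)},$$ $$\nabla_hv_h=\Big(\sum_{m,n}\mathrm i\nu m\,\widetilde v_{m,n}e^{\mathrm i\nu(mx+ny)},\ \sum_{m,n}\mathrm i\nu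 n\,\widetilde v_{m,n}e^{\mathrm i\nu(mx+ny)}\Big),\qquad \|\nabla_hv\|^2=h^2\sum_{\Omega_h}|\nabla_hv_h|^2 .$$ An *embedding constant* (for $L$ and $M$) is a number $c_z>0$ with $\|v\|_{l^6}\le c_z\|\nabla_hv\|$ for all $v\in\mathring{\mathbb V}_h$. *Time.* Let $r_{\mathrm{user}}\in(0,4.864)$. Consider step sizes $\tau_1,\dots,\tau_n>0$ with ratios $r_k=\tau_k/\tau_{k-1}\le r_{\mathrm{user}}$ for $2\le k\le n$. The BDF2 kernels are $b_0^{(k)}=\frac{1+2r_k}{\tau_k(1+r_k)}$, $b_1^{(k)}=-\frac{r_k^2}{\tau_k(1+r_k)}$ and $b_j^{(k)}=0$ for $j\ge2$. The DOC kernels are $$\theta_0^{(k)}=\frac1{b_0^{(k)}},\qquad \theta_{k-j}^{(k)}=-\frac1{b_0^{(j)}}\sum_{i=j+1}^k\theta_{k-i}^{(k)}b_{i-j}^{(i)}\quad(2\le j<k).$$ Write $\sum_{k,j}=\sum_{k=2}^n\sum_{j=2}^k$. Let $B_2=(b_{k-j}^{(k)})$ and $\Theta_2=(\theta_{k-j}^{(k)})$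 be the corresponding lower triangular $(n-1)\times(n-1)$ matrices, and $\Lambda=\mathrm{diag}(\sqrt{\tau_2},\dots,\sqrt{\tau_n})$. *Kernel constants* for the mesh are positive numbers $\mathfrak m_1,\mathfrak m_2,\mathfrak m_3$ such that $\mathfrak m_1\le\lambda_{\min}\big(\Lambda(B_2+B_2^T)\Lambda\big)$, $\mathfrak m_2\ge\lambda_{\max}\big((\Lambda B_2\Lambda)^T\Lambda B_2\Lambda\big)$ and $\mathfrak m_3\ge\lambda_{\max}\big(\Lambda^{-1}(\Theta_2+\Theta_2^T)\Lambda^{-1}\big)$. *Claim.* 1. There are $\mathfrak m_1,\mathfrak m_2,\mathfrak m_3$, depending only on $r_{\mathrm{user}}$, that are kernel constants for every such mesh and every $n$. For every $L>0$ there is $c_z$, depending only on $L$, that is an embedding constant for every even $M\ge2$. 2. For every such mesh and all its kernel constants $\mathfrak m_1,\mathfrak m_2,\mathfrak m_3$, all real sequences $(v^k),(w^k)$ and all $\varepsilon>0$, $$\frac{\mathfrak m_1}{\mathfrak m_2}\sum_{k=2}^n\tau_k(w^k)^2\le2\sum_{k,j}\theta_{k-j}^{(k)}w^kw^j\le\mathfrak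 m_3\sum_{k=2}^n\tau_k(w^k)^2,$$ $$\sum_{k,j}\theta_{k-j}^{(k)}w^kv^j\le\varepsilon\sum_{k=2}^n\tau_k(v^k)^2+\frac{\mathfrak m_3}{4\mathfrak m_1\varepsilon}\sum_{k=2}^n\tau_k(w^k)^2 .$$ 3. Let moreover $c_z$ be an embedding constant, $u^k\in\mathbb V_h$ and $v^k\in\mathring{\mathbb V}_h$ with $\|u^k\|_{l^3}\le c_u$ for $2\le k\le n$, where $c_u>0$. Then for every $\varepsilon>0$ and $\alpha\in(0,1)$ $$\sum_{k,j}\theta_{k-j}^{(k)}\big\langle u^jv^j,-(-\Delta_h)^{\alpha}v^k\big\rangle\le\varepsilon\sum_{k,j}\theta_{k-j}^{(k)}\big\langle(-\Delta_h)^{\frac{1+\alpha}2}v^j,(-\Delta_h)^{\frac{1+\alpha}2}v^k\big\rangle+\eta\sum_{k=2}^n\tau_k\|v^k\|^2,$$ where $$\eta=\frac{c^2c_u^2\,\mathfrak m_2\mathfrak m_3\,\alpha}{\varepsilon\,\mathfrak m_1^2(1+\alpha)\,\varepsilon_3^{(1+\alpha)/\alpha}},\qquad \varepsilon_3^{1+\alpha}=\frac{\varepsilon^2\mathfrak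 m_1^3(1+\alpha)}{4c^2c_u^2\,\mathfrak m_2^2\mathfrak m_3},\qquad c=\max\{1,\nu^{\alpha-1}\}\,c_z .$$ In particular $c=c_z$ if $L\le2\pi$. -/

import Mathlib

open Finset

noncomputable section

namespace FCH

/-! ### Time discretization: step ratios, BDF2 kernels and DOC kernels -/

/-- The local step ratio `r_k = τ_k / τ_{k-1}`, used for `k ≥ 2`. -/
def stepRatio (τ : ℕ → ℝ) (k : ℕ) : ℝ := τ k / τ (k - 1)

/-- The steps `τ_1, …, τ_n` are positive and `r_k ≤ rUser` for `2 ≤ k ≤ n`. -/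
structure IsMesh (rUser : ℝ) (n : ℕ) (τ : ℕ → ℝ) : Prop where
  pos : ∀ k ∈ Icc 1 n, 0 < τ k
  ratio_le : ∀ k ∈ Icc 2 n, stepRatio τ k ≤ rUser

/-- The variable-step BDF2 kernel `b_j^{(n)}`. -/
def bdfKernel (τ : ℕ → ℝ) (n : ℕ) : ℕ → ℝ
  | 0 => (1 + 2 * stepRatio τ n) / (τ n * (1 + stepRatio τ n))
  | 1 => -(stepRatio τ n ^ 2 / (τ n * (1 + stepRatio τ n)))
  | _ + 2 => 0

/-- The discrete orthogonal convolution (DOC) kernel `θ_j^{(n)}`, used for `j ≤ n - 2`: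
`θ_0^{(n)} = 1 / b_0^{(n)}` and, for `k = n - j < n`,
`θ_{n-k}^{(n)} = -(1 / b_0^{(k)}) ∑_{i=k+1}^{n} θ_{n-i}^{(n)} b_{i-k}^{(i)}`;
below, the summation index is `l = n - i`. -/
def docKernel (τ : ℕ → ℝ) (n : ℕ) : ℕ → ℝ
  | 0 => 1 / bdfKernel τ n 0
  | j + 1 => -(1 / bdfKernel τ (n - (j + 1)) 0) *
      ∑ l : Fin (j + 1), docKernel τ n l.1 * bdfKernel τ (n - l.1) (j + 1 - l.1)
  termination_by j => j
  decreasing_by exact l.2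

/-- `∑_{k=2}^{n} ∑_{j=2}^{k} θ_{k-j}^{(k)} F j k`. -/
def docSum (τ : ℕ → ℝ) (n : ℕ) (F : ℕ → ℕ → ℝ) : ℝ :=
  ∑ k ∈ Icc 2 n, ∑ j ∈ Icc 2 k, docKernel τ k (k - j) * F j k

/-- Positive spectral bounds for the kernel matrices `B₂ = (b_{k-j}^{(k)})` and
`Θ₂ = (θ_{k-j}^{(k)})`, `2 ≤ j ≤ k ≤ n`, scaled by `Λ = diag (√τ_2, …, √τ_n)`:
`m₁` bounds the eigenvalues of `Λ (B₂ + B₂ᵀ) Λ` from below,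
`m₂` bounds those of `(Λ B₂ Λ)ᵀ (Λ B₂ Λ)` from above, and
`m₃` bounds those of `Λ⁻¹ (Θ₂ + Θ₂ᵀ) Λ⁻¹` from above
(in the first two, the vector is `Λ⁻¹ w`). -/
structure IsKernelBound (n : ℕ) (τ : ℕ → ℝ) (m₁ m₂ m₃ : ℝ) : Prop where
  pos₁ : 0 < m₁
  pos₂ : 0 < m₂
  pos₃ : 0 < m₃
  lower : ∀ w : ℕ → ℝ, m₁ * ∑ k ∈ Icc 2 n, w k ^ 2 / τ k ≤
    2 * ∑ k ∈ Icc 2 n, w k * ∑ j ∈ Icc 2 k, bdfKernel τ k (k - j) * w j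
  upper : ∀ w : ℕ → ℝ,
    ∑ k ∈ Icc 2 n, τ k * (∑ j ∈ Icc 2 k, bdfKernel τ k (k - j) * w j) ^ 2 ≤
      m₂ * ∑ k ∈ Icc 2 n, w k ^ 2 / τ k
  doc_upper : ∀ w : ℕ → ℝ,
    2 * docSum τ n (fun j k => w k * w j) ≤ m₃ * ∑ k ∈ Icc 2 n, τ k * w k ^ 2

/-! ### Fourier pseudo-spectral discretization on `(0, L)²`, with `M × M` grid points -/

/-- Real grid functions; the index `(i, j)` stands for the grid point `(i h, j h)`. -/
abbrev Grid (M : ℕ) : Type := Fin M × Fin M → ℝ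

/-- The mesh size `h = L / M`. -/
def meshSize (L : ℝ) (M : ℕ) : ℝ := L / M

/-- The base frequency `ν = 2π / L`. -/
def freq (L : ℝ) : ℝ := 2 * Real.pi / L

/-- The discrete inner product `⟨v, w⟩ = h² ∑ v_h w_h`. -/
def gridInner {M : ℕ} (L : ℝ) (v w : Grid M) : ℝ :=
  meshSize L M ^ 2 * ∑ x, v x * w x

/-- The discrete `l²` norm. -/
def gridNorm {M : ℕ} (L : ℝ) (v : Grid M) : ℝ := Real.sqrt (gridInner L v v)

/-- The discrete `l^q` norm. -/
def lqNorm {M : ℕ} (L q : ℝ) (v : Grid M) : ℝ :=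
  (meshSize L M ^ 2 * ∑ x, |v x| ^ q) ^ (1 / q)

/-- Grid functions of mean zero. -/
def MeanZero {M : ℕ} (L : ℝ) (v : Grid M) : Prop := gridInner L v 1 = 0

/-- The modes `-M/2 ≤ m, n ≤ M/2 - 1` (for even `M`). -/
def modes (M : ℕ) : Finset (ℤ × ℤ) :=
  Icc (-((M : ℤ) / 2)) ((M : ℤ) / 2 - 1) ×ˢ Icc (-((M : ℤ) / 2)) ((M : ℤ) / 2 - 1)

/-- The value of `exp (iν(mx + ny))` at a grid point. -/
def wave {M : ℕ} (L : ℝ) (p : ℤ × ℤ) (x : Fin M × Fin M) : ℂ :=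
  Complex.exp (Complex.I * freq L *
    (p.1 * ((x.1 : ℕ) * meshSize L M) + p.2 * ((x.2 : ℕ) * meshSize L M)))

/-- The pseudo-spectral (discrete Fourier) coefficients, i.e. the coefficients of the
trigonometric interpolant, see `interpolation`. -/
def coeff {M : ℕ} (L : ℝ) (v : Grid M) (p : ℤ × ℤ) : ℂ :=
  1 / (M : ℂ) ^ 2 * ∑ x, v x * wave L (-p) x

/-- `λ_{m,n} = ν² (m² + n²)`. -/
def symbol (L : ℝ) (p : ℤ × ℤ) : ℝ := freq L ^ 2 * ((p.1 : ℝ) ^ 2 + (p.2 : ℝ) ^ 2)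

/-- The pseudo-spectral derivative in the first variable; the unpaired modes `-M/2` make it
complex valued. -/
def derivX {M : ℕ} (L : ℝ) (v : Grid M) (x : Fin M × Fin M) : ℂ :=
  ∑ p ∈ modes M, (Complex.I * freq L * p.1) * coeff L v p * wave L p x

/-- The pseudo-spectral derivative in the second variable. -/
def derivY {M : ℕ} (L : ℝ) (v : Grid M) (x : Fin M × Fin M) : ℂ :=
  ∑ p ∈ modes M, (Complex.I * freq L * p.2) * coeff L v p * wave L p x

/-- `‖∇_h v‖`, where `|∇_h v|² = |D_x v|² + |D_y v|²`. -/
def gradNorm {M : ℕ} (L : ℝ) (v : Grid M) : ℝ :=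
  Real.sqrt (meshSize L M ^ 2 * ∑ x, (‖derivX L v x‖ ^ 2 + ‖derivY L v x‖ ^ 2))

/-- The sum `∑_{(m,n) ≠ 0} λ_{m,n}^γ ṽ_{m,n} exp (iν(mx + ny))` at a grid point. -/
def fracLapSum {M : ℕ} (L γ : ℝ) (v : Grid M) (x : Fin M × Fin M) : ℂ :=
  ∑ p ∈ (modes M).erase 0, ((symbol L p ^ γ : ℝ) : ℂ) * coeff L v p * wave L p x

/-- The discrete fractional Laplacian `(-Δ_h)^γ`. Its defining sum is real on the grid
(see `fracLap_eq`), so taking the real part only changes the type. -/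
def fracLap {M : ℕ} (L γ : ℝ) (v : Grid M) : Grid M := fun x => (fracLapSum L γ v x).re

/-- `c` is a constant in the discrete embedding `‖v‖_{l⁶} ≤ c ‖∇_h v‖` for mean-zero grid
functions. -/
def IsEmbeddingConst (L : ℝ) (M : ℕ) (c : ℝ) : Prop :=
  0 < c ∧ ∀ v : Grid M, MeanZero L v → lqNorm L 6 v ≤ c * gradNorm L v

/-! ### The constant -/

/-- `ε₃`, given by `ε₃^{1+α} = ε² m₁³ (1+α) / (4 c² c_u² m₂² m₃)`. -/
def eps₃ (m₁ m₂ m₃ c cu α ε : ℝ) : ℝ :=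
  (ε ^ 2 * m₁ ^ 3 * (1 + α) / (4 * c ^ 2 * cu ^ 2 * m₂ ^ 2 * m₃)) ^ (1 / (1 + α))

/-- `η = c² c_u² m₂ m₃ α / (ε m₁² (1+α) ε₃^{(1+α)/α})`. -/
def eta (m₁ m₂ m₃ c cu α ε : ℝ) : ℝ :=
  c ^ 2 * cu ^ 2 * m₂ * m₃ * α /
    (ε * m₁ ^ 2 * (1 + α) * eps₃ m₁ m₂ m₃ c cu α ε ^ ((1 + α) / α))

/-! ### The interpolation property, and realness of the fractional Laplacian -/

theorem wave_eq {M : ℕ} {L : ℝ} (hL : 0 < L) (p : ℤ × ℤ) (x : Fin M × Fin M) :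
    wave L p x = Complex.exp (2 * Real.pi * Complex.I / M) ^ (p.1 * (x.1 : ℕ) + p.2 * (x.2 : ℕ)) := by
  have hM : (M : ℂ) ≠ 0 := by
    have := x.1.pos
    exact_mod_cast this.ne'
  have hL' : (L : ℂ) ≠ 0 := by exact_mod_cast hL.ne'
  rw [wave, ← Complex.exp_int_mul]
  congr 1
  simp only [freq, meshSize]
  push_cast
  field_simp

theorem root_pow {M : ℕ} (hM : 0 < M) :
    Complex.exp (2 * Real.pi * Complex.I / M) ^ (M : ℤ) = 1 := by
  rw [zpow_natCast]
  exact (Complex.isPrimitiveRoot_exp M hM.ne').pow_eq_one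

theorem wave_congr {M : ℕ} {L : ℝ} (hL : 0 < L) (p q : ℤ × ℤ) (x : Fin M × Fin M)
    (h₁ : (M : ℤ) ∣ p.1 - q.1) (h₂ : (M : ℤ) ∣ p.2 - q.2) : wave L p x = wave L q x := by
  obtain ⟨a, ha⟩ := h₁
  obtain ⟨b, hb⟩ := h₂
  rw [wave_eq hL, wave_eq hL]
  have e : p.1 * (x.1 : ℕ) + p.2 * (x.2 : ℕ) =
      (q.1 * (x.1 : ℕ) + q.2 * (x.2 : ℕ)) + (M : ℤ) * (a * (x.1 : ℕ) + b * (x.2 : ℕ)) := by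
    linear_combination (x.1 : ℤ) * ha + (x.2 : ℤ) * hb
  rw [e, zpow_add₀ (Complex.exp_ne_zero _), zpow_mul, root_pow x.1.pos, one_zpow, mul_one]

theorem wave_conj {M : ℕ} (L : ℝ) (p : ℤ × ℤ) (x : Fin M × Fin M) :
    (starRingEnd ℂ) (wave L p x) = wave L (-p) x := by
  rw [wave, ← Complex.exp_conj, wave]
  congr 1
  simp
  ring

theorem coeff_conj {M : ℕ} (L : ℝ) (v : Grid M) (p : ℤ × ℤ) :
    (starRingEnd ℂ) (coeff L v p) = coeff L v (-p) := by
  simp [coeff, wave_conj]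

theorem coeff_congr {M : ℕ} {L : ℝ} (hL : 0 < L) (v : Grid M) (p q : ℤ × ℤ)
    (h₁ : (M : ℤ) ∣ p.1 - q.1) (h₂ : (M : ℤ) ∣ p.2 - q.2) : coeff L v p = coeff L v q := by
  unfold coeff
  congr 1
  refine Finset.sum_congr rfl fun x _ => ?_
  rw [wave_congr hL (-p) (-q) x]
  · have e : (-p).1 - (-q).1 = -(p.1 - q.1) := by simp; ring
    rw [e]
    exact dvd_neg.mpr h₁
  · have e : (-p).2 - (-q).2 = -(p.2 - q.2) := by simp; ring
    rw [e]
    exact dvd_neg.mpr h₂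

theorem geom_modes {M : ℕ} (hM : 0 < M) (hE : Even M) (a : ℤ) (ha : |a| < M) :
    ∑ m ∈ Icc (-((M : ℤ) / 2)) ((M : ℤ) / 2 - 1),
      Complex.exp (2 * Real.pi * Complex.I / M) ^ (m * a) = if a = 0 then (M : ℂ) else 0 := by
  set ζ := Complex.exp (2 * Real.pi * Complex.I / M) with hζ
  have hζ0 : ζ ≠ 0 := Complex.exp_ne_zero _
  have hprim : IsPrimitiveRoot ζ M := Complex.isPrimitiveRoot_exp M hM.ne'
  obtain ⟨K, hK⟩ := hE
  have hK2 : (M : ℤ) / 2 = K := by omega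
  have hsum : ∑ m ∈ Icc (-((M : ℤ) / 2)) ((M : ℤ) / 2 - 1), ζ ^ (m * a) =
      ∑ l ∈ range M, ζ ^ (-(K : ℤ) * a) * (ζ ^ a) ^ l := by
    rw [hK2]
    refine Finset.sum_nbij' (fun m => (m + K).toNat) (fun l => (l : ℤ) - K) ?_ ?_ ?_ ?_ ?_
    · intro m hm
      simp only [mem_Icc, mem_range] at hm ⊢
      omega
    · intro l hl
      simp only [mem_Icc, mem_range] at hl ⊢
      omega
    · intro m hm
      simp only [mem_Icc] at hm
      omega
    · intro l hl
      simp
    · intro m hm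
      simp only [mem_Icc] at hm
      rw [← zpow_natCast, ← zpow_mul, ← zpow_add₀ hζ0]
      congr 1
      rw [Int.toNat_of_nonneg (by omega)]
      ring
  rw [hsum, ← Finset.mul_sum]
  split_ifs with h
  · simp [h]
  · have h1 : ζ ^ a ≠ 1 := by
      intro h1
      rw [hprim.zpow_eq_one_iff_dvd] at h1
      exact h (Int.eq_zero_of_abs_lt_dvd h1 ha)
    have h2 : (ζ ^ a) ^ M = 1 := by
      rw [← zpow_natCast, ← zpow_mul, mul_comm, zpow_mul, root_pow hM, one_zpow]
    rw [geom_sum_eq h1, h2, sub_self, zero_div, mul_zero]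

/-- `coeff` gives the coefficients of the trigonometric interpolant of `v`. -/
theorem interpolation {M : ℕ} {L : ℝ} (hL : 0 < L) (hE : Even M) (v : Grid M)
    (x : Fin M × Fin M) : ∑ p ∈ modes M, coeff L v p * wave L p x = v x := by
  have hM : 0 < M := x.1.pos
  have hM0 : (M : ℂ) ≠ 0 := by exact_mod_cast hM.ne'
  have key : ∀ y : Fin M × Fin M, ∑ p ∈ modes M, wave L (-p) y * wave L p x =
      if y = x then (M : ℂ) ^ 2 else 0 := by
    intro y
    have e : ∀ p : ℤ × ℤ, wave L (-p) y * wave L p x =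
        Complex.exp (2 * Real.pi * Complex.I / M) ^ (p.1 * ((x.1 : ℕ) - (y.1 : ℕ) : ℤ)) *
        Complex.exp (2 * Real.pi * Complex.I / M) ^ (p.2 * ((x.2 : ℕ) - (y.2 : ℕ) : ℤ)) := by
      intro p
      rw [wave_eq hL, wave_eq hL, ← zpow_add₀ (Complex.exp_ne_zero _),
        ← zpow_add₀ (Complex.exp_ne_zero _)]
      congr 1
      simp
      ring
    have h1 := x.1.isLt
    have h2 := x.2.isLt
    have h3 := y.1.isLt
    have h4 := y.2.isLt
    rw [Finset.sum_congr rfl fun p _ => e p, modes, Finset.sum_product]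
    simp only [← Finset.mul_sum]
    rw [← Finset.sum_mul, geom_modes hM hE _ (by rw [abs_lt]; omega),
      geom_modes hM hE _ (by rw [abs_lt]; omega)]
    by_cases hyx : y = x
    · subst hyx
      simp [sq]
    · rw [if_neg hyx]
      by_cases h5 : ((x.1 : ℕ) - (y.1 : ℕ) : ℤ) = 0
      · have h6 : ((x.2 : ℕ) - (y.2 : ℕ) : ℤ) ≠ 0 := by
          intro h6
          exact hyx (Prod.ext (Fin.ext (by omega)) (Fin.ext (by omega)))
        rw [if_neg h6, mul_zero]
      · rw [if_neg h5, zero_mul]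
  simp only [coeff, Finset.mul_sum, Finset.sum_mul]
  rw [Finset.sum_comm]
  have e2 : ∀ y : Fin M × Fin M,
      ∑ p ∈ modes M, 1 / (M : ℂ) ^ 2 * (v y * wave L (-p) y) * wave L p x =
      1 / (M : ℂ) ^ 2 * v y * (if y = x then (M : ℂ) ^ 2 else 0) := by
    intro y
    rw [← key y, Finset.mul_sum]
    exact Finset.sum_congr rfl fun p _ => by ring
  rw [Finset.sum_congr rfl fun y _ => e2 y]
  simp only [mul_ite, mul_zero, Finset.sum_ite_eq', Finset.mem_univ, if_true]
  field_simp

/-- The sum defining the discrete fractional Laplacian of a real grid function is real. -/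
theorem fracLap_eq {M : ℕ} {L : ℝ} (hL : 0 < L) (hE : Even M) (γ : ℝ) (v : Grid M)
    (x : Fin M × Fin M) : (fracLap L γ v x : ℂ) = fracLapSum L γ v x := by
  obtain ⟨K, hK⟩ := hE
  have hM : 0 < M := x.1.pos
  have hK2 : (M : ℤ) / 2 = K := by omega
  refine Complex.conj_eq_iff_re.mp ?_
  let s : ℤ → ℤ := fun m => if m = -(K : ℤ) then m else -m
  have hs : ∀ m : ℤ, (M : ℤ) ∣ -m - s m := by
    intro m
    by_cases h : m = -(K : ℤ)
    · simp only [s, h, if_true]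
      exact ⟨1, by omega⟩
    · simp [s, h]
  have hsq : ∀ m : ℤ, ((s m : ℤ) : ℝ) ^ 2 = (m : ℝ) ^ 2 := by
    intro m
    by_cases h : m = -(K : ℤ) <;> simp [s, h]
  have hss : ∀ m : ℤ, -(K : ℤ) ≤ m → m ≤ K - 1 → s (s m) = m := by
    intro m _ _
    simp only [s]
    split_ifs <;> omega
  have hs0 : ∀ m : ℤ, -(K : ℤ) ≤ m → m ≤ K - 1 →
      -(K : ℤ) ≤ s m ∧ s m ≤ K - 1 ∧ (s m = 0 ↔ m = 0) := by
    intro m _ _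
    simp only [s]
    split_ifs <;> omega
  have hmem : ∀ p ∈ (modes M).erase 0, (s p.1, s p.2) ∈ (modes M).erase 0 := by
    intro p hp
    simp only [modes, mem_erase, mem_product, mem_Icc, hK2, ne_eq, Prod.ext_iff, Prod.fst_zero,
      Prod.snd_zero] at hp ⊢
    obtain ⟨h0, ⟨h1, h2⟩, h3, h4⟩ := hp
    obtain ⟨a1, a2, a3⟩ := hs0 _ h1 h2
    obtain ⟨b1, b2, b3⟩ := hs0 _ h3 h4
    exact ⟨by rw [a3, b3]; exact h0, ⟨a1, a2⟩, b1, b2⟩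
  have hinv : ∀ p ∈ (modes M).erase 0, (s (s p.1), s (s p.2)) = p := by
    intro p hp
    simp only [modes, mem_erase, mem_product, mem_Icc, hK2] at hp
    exact Prod.ext (hss _ hp.2.1.1 hp.2.1.2) (hss _ hp.2.2.1 hp.2.2.2)
  rw [fracLapSum, map_sum]
  refine Finset.sum_nbij' (fun p => (s p.1, s p.2)) (fun p => (s p.1, s p.2))
    hmem hmem hinv hinv ?_
  intro p _
  rw [map_mul, map_mul, Complex.conj_ofReal, coeff_conj, wave_conj,
    coeff_congr hL v (-p) (s p.1, s p.2) (hs p.1) (hs p.2),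
    wave_congr hL (-p) (s p.1, s p.2) x (hs p.1) (hs p.2)]
  congr 3
  simp only [symbol, hsq]

end FCH

end

namespace FCH

/-! ### The DOC kernels invert the BDF2 kernels -/

/-! Everything rests on `Θ₂ = B₂⁻¹`. With `z = Θ₂ w` one has `w = B₂ z`, so `2 wᵀ Θ₂ w = 2 zᵀ B₂ z ≥
m₁ ∑ z²/τ` (`IsMesh.docConv_sq_le`), while `∑ τ w² ≤ m₂ ∑ z²/τ`. This gives the lower bound for the
DOC form. The bilinear inequality is Young's inequality for `wᵀ (Θ₂ v)`, with `∑ (Θ₂ v)²/τ`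
controlled through `m₁` and `m₃`.

Uniform kernel constants: in each row of `2 wᵀ B₂ w` the cross term is split by completing a square
(`bdf_step`), and the losses telescope against the next row. Positivity of what remains amounts to
`r³ < (1 + 2r)²` at `r = rUser`, which is where 4.864 comes from. The bounds for `m₂` and `m₃` are
then elementary.

Uniform embedding constant: `‖v‖_{l⁶}⁶ = ‖v³‖²`, and by Parseval this is the square sum of a
threefold convolution of the coefficients modulo `M`. Writing each coefficient as `‖p‖⁻¹ · (‖p‖
|ṽ_p|)`, Cauchy–Schwarz on the fibres (`triple_convolution_le`) bounds it by `(∑ ‖p‖⁻³)² ‖∇_h v‖⁶`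
up to a factor `L²`, and the lattice sum converges in dimension two.

Final inequality: scalar Young at each grid point separates `u v` from `(-Δ_h)^α v`. Hölder and the
embedding bound `‖u v‖` by `c_u c_z ‖∇_h v‖`, and Young in the symbol interpolates `‖∇_h v‖²`
between `‖(-Δ_h)^{(1+α)/2} v‖²` and `‖v‖²`. The weights are tuned so that the two top-order terms
together are absorbed by the DOC lower bound. -/

/-- Only the last summand survives, because `bdfKernel` vanishes from index 2 on. -/
theorem docKernel_succ (τ : ℕ → ℝ) (n j : ℕ) :
    docKernel τ n (j + 1) =
      -(1 / bdfKernel τ (n - (j + 1)) 0) * (docKernel τ n j * bdfKernel τ (n - j) 1) := by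
  rw [docKernel]
  congr 1
  rw [Fin.sum_univ_castSucc, Finset.sum_eq_zero]
  · simp
  · intro l _
    obtain ⟨d, hd⟩ : ∃ d, j + 1 - (l.castSucc : Fin (j + 1)).1 = d + 2 :=
      ⟨j - 1 - l.1, by have := l.2; simp; omega⟩
    rw [hd, bdfKernel, mul_zero]

/-- The definition of the DOC kernels encodes `Θ₂ B₂ = I`; this is the row recurrence behind `B₂ Θ₂
= I`. As `j` grows, both sides are multiplied by the same factor, so the case `j = 0` propagates. -/
theorem docKernel_succ_mul (τ : ℕ → ℝ) (n j : ℕ) (h : bdfKernel τ (n + 1) 0 ≠ 0) :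
    bdfKernel τ (n + 1) 0 * docKernel τ (n + 1) (j + 1) =
      -(bdfKernel τ (n + 1) 1 * docKernel τ n j) := by
  induction j with
  | zero =>
    rw [docKernel_succ, docKernel, docKernel]
    simp only [zero_add, Nat.add_sub_cancel, Nat.sub_zero]
    field_simp
  | succ j ih =>
    rw [docKernel_succ, docKernel_succ τ n j, Nat.add_sub_add_right, Nat.add_sub_add_right]
    linear_combination (-(1 / bdfKernel τ (n - (j + 1)) 0) * bdfKernel τ (n - j) 1) * ih

/-- The DOC convolution `∑_{j=2}^{k} θ_{k-j}^{(k)} w^j`. -/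
noncomputable def docConv (τ w : ℕ → ℝ) (k : ℕ) : ℝ := ∑ j ∈ Icc 2 k, docKernel τ k (k - j) * w j

theorem docConv_one (τ w : ℕ → ℝ) : docConv τ w 1 = 0 := by simp [docConv]

theorem docConv_succ (τ w : ℕ → ℝ) {k : ℕ} (hk : 1 ≤ k) (h : bdfKernel τ (k + 1) 0 ≠ 0) :
    bdfKernel τ (k + 1) 0 * docConv τ w (k + 1) + bdfKernel τ (k + 1) 1 * docConv τ w k =
      w (k + 1) := by
  rw [docConv, sum_Icc_succ_top (by omega), mul_add, Nat.sub_self, docKernel, mul_sum]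
  have e : ∀ j ∈ Icc 2 k,
      bdfKernel τ (k + 1) 0 * (docKernel τ (k + 1) (k + 1 - j) * w j) =
        -(bdfKernel τ (k + 1) 1 * (docKernel τ k (k - j) * w j)) := by
    intro j hj
    rw [mem_Icc] at hj
    rw [Nat.sub_add_comm hj.2, ← mul_assoc, docKernel_succ_mul τ k _ h]
    ring
  rw [sum_congr rfl e, sum_neg_distrib, ← mul_sum, ← docConv]
  field_simp
  ring

theorem docSum_mul (τ v w : ℕ → ℝ) (n : ℕ) :
    docSum τ n (fun j k => w k * v j) = ∑ k ∈ Icc 2 n, w k * docConv τ v k := by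
  simp only [docSum, docConv, mul_sum]
  exact sum_congr rfl fun k _ => sum_congr rfl fun j _ => by ring

/-- The normalization `w 1 = 0` lets the first row, which has no subdiagonal entry, share the
two-term form of the others. -/
theorem bdf_sum (τ w : ℕ → ℝ) (hw : w 1 = 0) {k : ℕ} (hk : 1 ≤ k) :
    ∑ j ∈ Icc 2 (k + 1), bdfKernel τ (k + 1) (k + 1 - j) * w j =
      bdfKernel τ (k + 1) 0 * w (k + 1) + bdfKernel τ (k + 1) 1 * w k := by
  rw [sum_Icc_succ_top (by omega), Nat.sub_self, add_comm]
  congr 1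
  obtain ⟨k, rfl⟩ : ∃ l, k = l + 1 := ⟨k - 1, by omega⟩
  rcases Nat.eq_zero_or_pos k with rfl | hk0
  · simp [hw]
  · rw [sum_Icc_succ_top (by omega), sum_eq_zero, zero_add, Nat.add_sub_cancel_left]
    intro j hj
    rw [mem_Icc] at hj
    obtain ⟨d, hd⟩ : ∃ d, k + 1 + 1 - j = d + 2 := ⟨k - j, by omega⟩
    rw [hd, bdfKernel, zero_mul]

variable {rUser : ℝ} {n : ℕ} {τ : ℕ → ℝ}

theorem IsMesh.mono {m : ℕ} (h : IsMesh rUser n τ) (hmn : m ≤ n) : IsMesh rUser m τ :=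
  ⟨fun k hk => h.pos k (Icc_subset_Icc_right hmn hk),
    fun k hk => h.ratio_le k (Icc_subset_Icc_right hmn hk)⟩

theorem IsMesh.pos' (h : IsMesh rUser n τ) {k : ℕ} (hk : k ∈ Icc 2 n) : 0 < τ k :=
  h.pos k (Icc_subset_Icc_left (by norm_num) hk)

theorem IsMesh.ratio_pos (h : IsMesh rUser n τ) {k : ℕ} (hk : k ∈ Icc 2 n) :
    0 < stepRatio τ k := by
  refine div_pos (h.pos' hk) (h.pos _ ?_)
  rw [mem_Icc] at hk ⊢
  omega

theorem IsMesh.bdfKernel_pos (h : IsMesh rUser n τ) {k : ℕ} (hk : k ∈ Icc 2 n) :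
    0 < bdfKernel τ k 0 := by
  have h1 := h.ratio_pos hk
  have h2 := h.pos' hk
  rw [bdfKernel]
  positivity

theorem IsMesh.bdf_docConv (h : IsMesh rUser n τ) (w : ℕ → ℝ) {k : ℕ} (hk : k ∈ Icc 2 n) :
    ∑ j ∈ Icc 2 k, bdfKernel τ k (k - j) * docConv τ w j = w k := by
  have h0 := (h.bdfKernel_pos hk).ne'
  rw [mem_Icc] at hk
  obtain ⟨k, rfl⟩ : ∃ l, k = l + 1 := ⟨k - 1, by omega⟩
  rw [bdf_sum τ _ (docConv_one τ w) (by omega), docConv_succ τ w (by omega) h0]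

/-! ### The DOC inequalities -/

variable {m₁ m₂ m₃ : ℝ}

theorem IsMesh.docConv_sq_le (h : IsMesh rUser n τ) (w : ℕ → ℝ)
    (hl : ∀ w : ℕ → ℝ, m₁ * ∑ k ∈ Icc 2 n, w k ^ 2 / τ k ≤
      2 * ∑ k ∈ Icc 2 n, w k * ∑ j ∈ Icc 2 k, bdfKernel τ k (k - j) * w j) :
    m₁ * ∑ k ∈ Icc 2 n, docConv τ w k ^ 2 / τ k ≤ 2 * docSum τ n (fun j k => w k * w j) := by
  refine (hl (docConv τ w)).trans_eq ?_
  rw [docSum_mul]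
  congr 1
  exact sum_congr rfl fun k hk => by rw [h.bdf_docConv w hk, mul_comm]

theorem IsMesh.doc_lower (h : IsMesh rUser n τ) (hm : IsKernelBound n τ m₁ m₂ m₃) (w : ℕ → ℝ) :
    m₁ / m₂ * ∑ k ∈ Icc 2 n, τ k * w k ^ 2 ≤ 2 * docSum τ n (fun j k => w k * w j) := by
  refine le_trans ?_ (h.docConv_sq_le w hm.lower)
  have h2 := hm.upper (docConv τ w)
  rw [sum_congr rfl fun k hk => by rw [h.bdf_docConv w hk]] at h2
  rw [div_mul_eq_mul_div, div_le_iff₀ hm.pos₂, mul_assoc]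
  refine mul_le_mul_of_nonneg_left (h2.trans_eq (mul_comm _ _)) hm.pos₁.le

theorem IsMesh.sum_mul_le (h : IsMesh rUser n τ) (w z : ℕ → ℝ) {ε : ℝ} (hε : 0 < ε) :
    ∑ k ∈ Icc 2 n, w k * z k ≤
      ε * ∑ k ∈ Icc 2 n, z k ^ 2 / τ k + 1 / (4 * ε) * ∑ k ∈ Icc 2 n, τ k * w k ^ 2 := by
  rw [mul_sum, mul_sum, ← sum_add_distrib]
  refine sum_le_sum fun k hk => ?_
  have ht := h.pos' hk
  have e : ε * (z k ^ 2 / τ k) + 1 / (4 * ε) * (τ k * w k ^ 2) - w k * z k =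
      (2 * ε * z k - τ k * w k) ^ 2 / (4 * ε * τ k) := by
    field_simp
    ring
  have : 0 ≤ (2 * ε * z k - τ k * w k) ^ 2 / (4 * ε * τ k) := by positivity
  linarith

theorem IsMesh.doc_young (h : IsMesh rUser n τ) (hm : IsKernelBound n τ m₁ m₂ m₃)
    (v w : ℕ → ℝ) {ε : ℝ} (hε : 0 < ε) :
    docSum τ n (fun j k => w k * v j) ≤
      ε * ∑ k ∈ Icc 2 n, τ k * v k ^ 2 +
        m₃ / (4 * m₁ * ε) * ∑ k ∈ Icc 2 n, τ k * w k ^ 2 := by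
  have h1 := hm.pos₁
  have h3 := hm.pos₃
  rw [docSum_mul]
  have hz := (h.docConv_sq_le v hm.lower).trans (hm.doc_upper v)
  -- The weight compensates the factor `m₃ / m₁` lost in passing from `∑ z²/τ` to `∑ τ v²`.
  refine (h.sum_mul_le w (docConv τ v) (ε := ε * m₁ / m₃) (by positivity)).trans ?_
  refine add_le_add ?_ (le_of_eq ?_)
  · rw [div_mul_eq_mul_div, div_le_iff₀ h3, mul_assoc, mul_assoc]
    exact mul_le_mul_of_nonneg_left (hz.trans_eq (mul_comm _ _)) hε.le
  · congr 1
    field_simp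

/-! ### Existence of the kernel constants -/

theorem sum_truncate (w : ℕ → ℝ) (F : ℕ → ℝ → ℝ) (n : ℕ) :
    ∑ k ∈ Icc 2 n, F k (if k = 1 then 0 else w k) = ∑ k ∈ Icc 2 n, F k (w k) := by
  refine sum_congr rfl fun k hk => ?_
  rw [if_neg]
  rw [mem_Icc] at hk
  omega

/-- With `g = A³/(1 + A²)`, the function `2 + 4a² - a³ - g(1 + a²)` is concave in `a²`, so on `[0,
A]` it is at least the smaller of its end values `2 - g` and `2 + 4A² - 2A³`. The hypothesis `h`
makes both positive. -/
theorem cubic_lower {A a : ℝ} (hA : 0 < A) (ha : 0 ≤ a) (haA : a ≤ A) (h : A ^ 3 < 1 + 2 * A ^ 2) :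
    min (2 + 4 * A ^ 2 - 2 * A ^ 3) (2 - A ^ 3 / (1 + A ^ 2)) / (1 + A ^ 2) +
      A ^ 3 / (1 + A ^ 2) ≤ (2 + 4 * a ^ 2 - a ^ 3) / (1 + a ^ 2) := by
  set g := A ^ 3 / (1 + A ^ 2) with hg
  set μ := min (2 + 4 * A ^ 2 - 2 * A ^ 3) (2 - g) with hμ
  have hgA : g * (1 + A ^ 2) = A ^ 3 := by rw [hg]; field_simp
  have hg2 : g < 2 := by rw [hg, div_lt_iff₀ (by positivity)]; nlinarith [sq_nonneg A]
  have hμ0 : 0 ≤ μ := le_min (by linarith) (by linarith)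
  have h1 : μ ≤ 2 + 4 * A ^ 2 - 2 * A ^ 3 := min_le_left _ _
  have h2 : μ ≤ 2 - g := min_le_right _ _
  have haA2 : a ^ 2 ≤ A ^ 2 := by gcongr
  have key : μ ≤ 2 + 4 * a ^ 2 - a ^ 3 - g * (1 + a ^ 2) := by
    refine le_of_mul_le_mul_left ?_ (by positivity : 0 < A ^ 2)
    have e1 := mul_le_mul_of_nonneg_left h1 (sq_nonneg a)
    have e2 := mul_le_mul_of_nonneg_left h2 (sub_nonneg.2 haA2)
    -- This is the gap between the concave function and its chord, multiplied by `A²`.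
    have e3 : 0 ≤ A ^ 2 * a ^ 2 * (A - a) :=
      mul_nonneg (by positivity) (sub_nonneg.2 haA)
    nlinarith [hgA]
  have e4 : μ / (1 + A ^ 2) * (1 + a ^ 2) ≤ μ := by
    rw [div_mul_eq_mul_div, div_le_iff₀ (by positivity)]
    exact mul_le_mul_of_nonneg_left (by linarith) hμ0
  rw [le_div_iff₀ (by positivity)]
  linarith

theorem cubic_div_mono {A a : ℝ} (ha : 0 ≤ a) (haA : a ≤ A) :
    a ^ 3 / (1 + a ^ 2) ≤ A ^ 3 / (1 + A ^ 2) := by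
  have hA : 0 ≤ A := ha.trans haA
  rw [div_le_div_iff₀ (by positivity) (by positivity)]
  have h1 : a ^ 3 ≤ A ^ 3 := by gcongr
  have h2 : a ^ 2 * A ^ 2 * a ≤ a ^ 2 * A ^ 2 * A := by gcongr
  nlinarith

/-- The cross term is split with the square `(x - a y)²`, where `a` is the root of the step ratio.
This costs the same amount `a³/(1 + a²)` in each of the scaled quantities `x²/s` and `y²/t`, and the
`y` loss is paid for by the reserve `g` of the preceding row. -/
theorem bdf_step {t s a x y m g : ℝ} (ht : 0 < t) (hs : 0 < s) (ha : 0 < a) (hr : s / t = a ^ 2)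
    (h1 : m + g ≤ (2 + 4 * a ^ 2 - a ^ 3) / (1 + a ^ 2)) (h2 : a ^ 3 / (1 + a ^ 2) ≤ g) :
    (m + g) * (x ^ 2 / s) - g * (y ^ 2 / t) ≤
      2 * (x * ((1 + 2 * (s / t)) / (s * (1 + s / t)) * x +
        -((s / t) ^ 2 / (s * (1 + s / t))) * y)) := by
  obtain rfl : s = a ^ 2 * t := by rw [← hr]; field_simp
  rw [hr]
  have e1 := mul_le_mul_of_nonneg_right h1 (by positivity : 0 ≤ x ^ 2 / (a ^ 2 * t))
  have e2 := mul_le_mul_of_nonneg_right h2 (by positivity : 0 ≤ y ^ 2 / t)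
  have e3 : 2 * (x * ((1 + 2 * a ^ 2) / (a ^ 2 * t * (1 + a ^ 2)) * x +
        -((a ^ 2) ^ 2 / (a ^ 2 * t * (1 + a ^ 2))) * y)) -
      ((2 + 4 * a ^ 2 - a ^ 3) / (1 + a ^ 2) * (x ^ 2 / (a ^ 2 * t)) -
        a ^ 3 / (1 + a ^ 2) * (y ^ 2 / t)) = a * (x - a * y) ^ 2 / (t * (1 + a ^ 2)) := by
    field_simp
    ring
  have e4 : 0 ≤ a * (x - a * y) ^ 2 / (t * (1 + a ^ 2)) := by positivity
  linarith

theorem IsMesh.bdf_lower {m g : ℝ} (hg : 0 ≤ g)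
    (h1 : ∀ a, 0 < a → a ^ 2 ≤ rUser → m + g ≤ (2 + 4 * a ^ 2 - a ^ 3) / (1 + a ^ 2))
    (h2 : ∀ a, 0 < a → a ^ 2 ≤ rUser → a ^ 3 / (1 + a ^ 2) ≤ g) (h : IsMesh rUser n τ)
    (w : ℕ → ℝ) : m * ∑ k ∈ Icc 2 n, w k ^ 2 / τ k ≤
      2 * ∑ k ∈ Icc 2 n, w k * ∑ j ∈ Icc 2 k, bdfKernel τ k (k - j) * w j := by
  -- No sum involves the value at 1, so it may be set to zero.
  wlog hw : w 1 = 0 generalizing w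
  · have := this (fun k => if k = 1 then 0 else w k) (by simp)
    rw [sum_truncate w (fun k x => x ^ 2 / τ k),
      sum_truncate w (fun k x => x * ∑ j ∈ Icc 2 k, bdfKernel τ k (k - j) *
        (if j = 1 then 0 else w j))] at this
    simpa only [fun k => sum_truncate w (fun j x => bdfKernel τ k (k - j) * x) k] using this
  rcases Nat.eq_zero_or_pos n with rfl | hn
  · simp
  -- The induction carries the reserve `g * (w n ^ 2 / τ n)`, which the next row consumes. It
  -- vanishes at the start `n = 1`.
  have key : m * ∑ k ∈ Icc 2 n, w k ^ 2 / τ k + g * (w n ^ 2 / τ n) ≤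
      2 * ∑ k ∈ Icc 2 n, w k * ∑ j ∈ Icc 2 k, bdfKernel τ k (k - j) * w j := by
    induction n, hn using Nat.le_induction with
    | base => simp [hw]
    | succ n hn ih =>
      have ih' := ih (h.mono n.le_succ)
      have hk : n + 1 ∈ Icc 2 (n + 1) := by rw [mem_Icc]; omega
      have hr := h.ratio_pos hk
      have hsq := Real.sq_sqrt hr.le
      have hle : √(stepRatio τ (n + 1)) ^ 2 ≤ rUser := hsq.trans_le (h.ratio_le _ hk)
      have step := bdf_step (x := w (n + 1)) (y := w n)
        (h.pos n (by rw [mem_Icc]; omega)) (h.pos' hk) (Real.sqrt_pos.2 hr)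
        hsq.symm (h1 _ (Real.sqrt_pos.2 hr) hle) (h2 _ (Real.sqrt_pos.2 hr) hle)
      rw [sum_Icc_succ_top (by omega), sum_Icc_succ_top (by omega), bdf_sum τ w hw hn]
      have e0 : bdfKernel τ (n + 1) 0 = (1 + 2 * (τ (n + 1) / τ n)) /
        (τ (n + 1) * (1 + τ (n + 1) / τ n)) := rfl
      have e1 : bdfKernel τ (n + 1) 1 = -((τ (n + 1) / τ n) ^ 2 /
        (τ (n + 1) * (1 + τ (n + 1) / τ n))) := rfl
      rw [e0, e1]
      linarith
  have : 0 ≤ g * (w n ^ 2 / τ n) :=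
    mul_nonneg hg (div_nonneg (sq_nonneg _) (h.pos n (by rw [mem_Icc]; omega)).le)
  linarith

/-- This is `(p + q)² ≤ 2p² + 2q²` with `(1 + 2r)/(1 + r) ≤ 2` and `r³/(1 + r)² ≤ R³`. Each `w k`
enters at most two rows, whence the total `8 + 2R³` in `IsMesh.bdf_upper`. -/
theorem bdf_step_upper {t s r R x y : ℝ} (ht : 0 < t) (hr : 0 < r) (hs : s = r * t)
    (hR : r ≤ R) :
    s * ((1 + 2 * r) / (s * (1 + r)) * x + -(r ^ 2 / (s * (1 + r))) * y) ^ 2 ≤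
      8 * (x ^ 2 / s) + 2 * R ^ 3 * (y ^ 2 / t) := by
  subst hs
  have e0 : (1 + 2 * r) / (1 + r) ≤ 2 := by rw [div_le_iff₀ (by positivity)]; linarith
  have e1 : ((1 + 2 * r) / (1 + r)) ^ 2 ≤ 2 ^ 2 := by gcongr
  have e2 : r ^ 3 / (1 + r) ^ 2 ≤ R ^ 3 := by
    refine (div_le_self (by positivity) (by nlinarith)).trans (by gcongr)
  have e3 := mul_le_mul_of_nonneg_right e1 (by positivity : 0 ≤ x ^ 2 / (r * t))
  have e4 := mul_le_mul_of_nonneg_right e2 (by positivity : 0 ≤ y ^ 2 / t)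
  have e5 : 2 * (((1 + 2 * r) / (1 + r)) ^ 2 * (x ^ 2 / (r * t))) +
      2 * (r ^ 3 / (1 + r) ^ 2 * (y ^ 2 / t)) -
      r * t * ((1 + 2 * r) / (r * t * (1 + r)) * x + -(r ^ 2 / (r * t * (1 + r))) * y) ^ 2 =
      ((1 + 2 * r) * x + r ^ 2 * y) ^ 2 / (r * t * (1 + r) ^ 2) := by
    field_simp
    ring
  have e6 : 0 ≤ ((1 + 2 * r) * x + r ^ 2 * y) ^ 2 / (r * t * (1 + r) ^ 2) := by positivity
  linarith

theorem IsMesh.bdf_upper (hr₀ : 0 < rUser) (h : IsMesh rUser n τ) (w : ℕ → ℝ) :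
    ∑ k ∈ Icc 2 n, τ k * (∑ j ∈ Icc 2 k, bdfKernel τ k (k - j) * w j) ^ 2 ≤
      (8 + 2 * rUser ^ 3) * ∑ k ∈ Icc 2 n, w k ^ 2 / τ k := by
  wlog hw : w 1 = 0 generalizing w
  · have := this (fun k => if k = 1 then 0 else w k) (by simp)
    rw [sum_truncate w (fun k x => x ^ 2 / τ k)] at this
    simpa only [fun k => sum_truncate w (fun j x => bdfKernel τ k (k - j) * x) k] using this
  rcases Nat.eq_zero_or_pos n with rfl | hn
  · simp
  have key : ∑ k ∈ Icc 2 n, τ k * (∑ j ∈ Icc 2 k, bdfKernel τ k (k - j) * w j) ^ 2 +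
      2 * rUser ^ 3 * (w n ^ 2 / τ n) ≤
      (8 + 2 * rUser ^ 3) * ∑ k ∈ Icc 2 n, w k ^ 2 / τ k := by
    induction n, hn using Nat.le_induction with
    | base => simp [hw]
    | succ n hn ih =>
      have ih' := ih (h.mono n.le_succ)
      have hk : n + 1 ∈ Icc 2 (n + 1) := by rw [mem_Icc]; omega
      have ht := h.pos n (by rw [mem_Icc]; omega)
      have step := bdf_step_upper (s := τ (n + 1)) (x := w (n + 1)) (y := w n) ht
        (h.ratio_pos hk) (by simp only [stepRatio, Nat.add_sub_cancel]; field_simp)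
        (h.ratio_le _ hk)
      rw [sum_Icc_succ_top (by omega), bdf_sum τ w hw hn, sum_Icc_succ_top (by omega)]
      have e0 : bdfKernel τ (n + 1) 0 = (1 + 2 * stepRatio τ (n + 1)) /
        (τ (n + 1) * (1 + stepRatio τ (n + 1))) := rfl
      have e1 : bdfKernel τ (n + 1) 1 = -(stepRatio τ (n + 1) ^ 2 /
        (τ (n + 1) * (1 + stepRatio τ (n + 1)))) := rfl
      rw [e0, e1]
      linarith
  have : 0 ≤ 2 * rUser ^ 3 * (w n ^ 2 / τ n) :=
    mul_nonneg (by positivity) (div_nonneg (sq_nonneg _) (h.pos n (by rw [mem_Icc]; omega)).le)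
  linarith

theorem IsMesh.doc_upper (h : IsMesh rUser n τ) (hm₁ : 0 < m₁)
    (hl : ∀ w : ℕ → ℝ, m₁ * ∑ k ∈ Icc 2 n, w k ^ 2 / τ k ≤
      2 * ∑ k ∈ Icc 2 n, w k * ∑ j ∈ Icc 2 k, bdfKernel τ k (k - j) * w j) (w : ℕ → ℝ) :
    2 * docSum τ n (fun j k => w k * w j) ≤ 4 / m₁ * ∑ k ∈ Icc 2 n, τ k * w k ^ 2 := by
  have h1 := h.docConv_sq_le w hl
  -- With weight `m₁ / 4` the `z` term is at most half of the form itself and is absorbed on the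
  -- left.
  have h2 := h.sum_mul_le w (docConv τ w) (ε := m₁ / 4) (by positivity)
  rw [← docSum_mul, show 1 / (4 * (m₁ / 4)) = 1 / m₁ by ring] at h2
  have e : 4 / m₁ * ∑ k ∈ Icc 2 n, τ k * w k ^ 2 =
    4 * (1 / m₁ * ∑ k ∈ Icc 2 n, τ k * w k ^ 2) := by ring
  linarith

theorem exists_isKernelBound (hr₀ : 0 < rUser) (hr : rUser < 4.864) :
    ∃ m₁ m₂ m₃ : ℝ, ∀ (n : ℕ) (τ : ℕ → ℝ), IsMesh rUser n τ →
      IsKernelBound n τ m₁ m₂ m₃ := by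
  set A := √rUser with hA
  have hA0 : 0 < A := Real.sqrt_pos.2 hr₀
  have hA2 : A ^ 2 = rUser := Real.sq_sqrt hr₀.le
  -- After squaring this reads `r³ < (1 + 2r)²` with `r = rUser`. It holds below 4.864, just short
  -- of the positive root of `r³ = (1 + 2r)²`.
  have hc : A ^ 3 < 1 + 2 * A ^ 2 := by
    refine lt_of_pow_lt_pow_left₀ 2 (by positivity) ?_
    rw [← pow_mul, mul_comm 3 2, pow_mul, hA2]
    norm_num at hr
    nlinarith [mul_pos hr₀ (sub_pos.2 hr), mul_pos (mul_pos hr₀ hr₀) (sub_pos.2 hr)]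
  have hg2 : A ^ 3 / (1 + A ^ 2) < 2 := by
    rw [div_lt_iff₀ (by positivity)]; nlinarith [sq_nonneg A]
  set m := min (2 + 4 * A ^ 2 - 2 * A ^ 3) (2 - A ^ 3 / (1 + A ^ 2)) / (1 + A ^ 2) with hm
  have hm0 : 0 < m := div_pos (lt_min (by linarith) (by linarith)) (by positivity)
  refine ⟨m, 8 + 2 * rUser ^ 3, 4 / m, fun n τ h => ?_⟩
  have hle : ∀ a : ℝ, a ^ 2 ≤ rUser → a ≤ A := fun a ha => Real.le_sqrt_of_sq_le ha
  have hl := h.bdf_lower (m := m) (g := A ^ 3 / (1 + A ^ 2)) (by positivity)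
    (fun a ha haR => cubic_lower hA0 ha.le (hle a haR) hc)
    (fun a ha haR => cubic_div_mono ha.le (hle a haR))
  exact ⟨hm0, by positivity, by positivity, hl, h.bdf_upper hr₀, h.doc_upper hm0 hl⟩




/-! ### Parseval's identity -/

theorem geom_grid {M : ℕ} (hM : 0 < M) (a : ℤ) (ha : |a| < M) :
    ∑ i : Fin M, Complex.exp (2 * Real.pi * Complex.I / M) ^ (a * (i : ℕ)) =
      if a = 0 then (M : ℂ) else 0 := by
  set ζ := Complex.exp (2 * Real.pi * Complex.I / M) with hζ
  have hprim : IsPrimitiveRoot ζ M := Complex.isPrimitiveRoot_exp M hM.ne'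
  simp only [zpow_mul, zpow_natCast]
  rw [Fin.sum_univ_eq_sum_range (fun i => (ζ ^ a) ^ i)]
  split_ifs with h
  · simp [h]
  · have h1 : ζ ^ a ≠ 1 := fun h1 =>
      h (Int.eq_zero_of_abs_lt_dvd ((hprim.zpow_eq_one_iff_dvd a).1 h1) ha)
    have h2 : (ζ ^ a) ^ M = 1 := by
      rw [← zpow_natCast, ← zpow_mul, mul_comm, zpow_mul, root_pow hM, one_zpow]
    rw [geom_sum_eq h1, h2, sub_self, zero_div]

theorem mem_modes {M : ℕ} {p : ℤ × ℤ} : p ∈ modes M ↔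
    (-((M : ℤ) / 2) ≤ p.1 ∧ p.1 ≤ (M : ℤ) / 2 - 1) ∧
      -((M : ℤ) / 2) ≤ p.2 ∧ p.2 ≤ (M : ℤ) / 2 - 1 := by
  simp only [modes, mem_product, mem_Icc]

theorem wave_orthogonal {M : ℕ} {L : ℝ} (hL : 0 < L) (hM : 0 < M) {p q : ℤ × ℤ}
    (hp : p ∈ modes M) (hq : q ∈ modes M) :
    ∑ x : Fin M × Fin M, wave L p x * (starRingEnd ℂ) (wave L q x) =
      if p = q then (M : ℂ) ^ 2 else 0 := by
  rw [mem_modes] at hp hq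
  have e : ∀ x : Fin M × Fin M, wave L p x * (starRingEnd ℂ) (wave L q x) =
      Complex.exp (2 * Real.pi * Complex.I / M) ^ ((p.1 - q.1) * (x.1 : ℕ)) *
      Complex.exp (2 * Real.pi * Complex.I / M) ^ ((p.2 - q.2) * (x.2 : ℕ)) := by
    intro x
    rw [wave_conj, wave_eq hL, wave_eq hL, ← zpow_add₀ (Complex.exp_ne_zero _),
      ← zpow_add₀ (Complex.exp_ne_zero _)]
    congr 1
    simp
    ring
  rw [Fintype.sum_congr _ _ e, Fintype.sum_prod_type]
  simp only [← Finset.mul_sum]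
  rw [← Finset.sum_mul, geom_grid hM _ (by rw [abs_lt]; omega),
    geom_grid hM _ (by rw [abs_lt]; omega)]
  simp only [sub_eq_zero, Prod.ext_iff]
  by_cases h1 : p.1 = q.1 <;> by_cases h2 : p.2 = q.2 <;> simp [h1, h2, sq]

/-- Arbitrary coefficients on a subset of the modes are allowed, so that one statement serves `v`,
`v³`, the complex-valued derivatives, and the fractional Laplacian with its zero mode removed. -/
theorem parseval {M : ℕ} {L : ℝ} (hL : 0 < L) (hM : 0 < M) {S : Finset (ℤ × ℤ)}
    (hS : S ⊆ modes M) (G : ℤ × ℤ → ℂ) :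
    ∑ x : Fin M × Fin M, ‖∑ p ∈ S, G p * wave L p x‖ ^ 2 = (M : ℝ) ^ 2 * ∑ p ∈ S, ‖G p‖ ^ 2 := by
  apply Complex.ofReal_injective
  push_cast
  simp only [← Complex.mul_conj', map_sum, map_mul, sum_mul_sum]
  rw [sum_comm, mul_sum]
  refine sum_congr rfl fun p hp => ?_
  rw [sum_comm]
  have e : ∀ q ∈ S, ∑ x : Fin M × Fin M, G p * wave L p x *
      ((starRingEnd ℂ) (G q) * (starRingEnd ℂ) (wave L q x)) =
      if p = q then (M : ℂ) ^ 2 * (G p * (starRingEnd ℂ) (G q)) else 0 := by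
    intro q hq
    rw [sum_congr rfl fun x _ => mul_mul_mul_comm (G p) (wave L p x) _ _, ← mul_sum,
      wave_orthogonal hL hM (hS hp) (hS hq)]
    split_ifs <;> ring
  rw [sum_congr rfl e, sum_ite_eq, if_pos hp]

theorem meshSize_sq_mul {M : ℕ} (L : ℝ) (hM : 0 < M) : meshSize L M ^ 2 * (M : ℝ) ^ 2 = L ^ 2 := by
  have : (M : ℝ) ≠ 0 := by exact_mod_cast hM.ne'
  rw [meshSize]
  field_simp

theorem gridInner_self {M : ℕ} {L : ℝ} (hL : 0 < L) (hM : 0 < M) (v : Grid M)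
    {S : Finset (ℤ × ℤ)} (hS : S ⊆ modes M) (G : ℤ × ℤ → ℂ)
    (hv : ∀ x, (v x : ℂ) = ∑ p ∈ S, G p * wave L p x) :
    gridInner L v v = L ^ 2 * ∑ p ∈ S, ‖G p‖ ^ 2 := by
  rw [← meshSize_sq_mul L hM, mul_assoc, ← parseval hL hM hS, gridInner]
  simp [← hv, sq]

theorem gridInner_self_nonneg {M : ℕ} (L : ℝ) (v : Grid M) : 0 ≤ gridInner L v v :=
  mul_nonneg (sq_nonneg _) (sum_nonneg fun x _ => mul_self_nonneg (v x))

theorem gridNorm_sq {M : ℕ} (L : ℝ) (v : Grid M) : gridNorm L v ^ 2 = gridInner L v v :=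
  Real.sq_sqrt (gridInner_self_nonneg L v)

theorem gridNorm_sq_eq {M : ℕ} {L : ℝ} (hL : 0 < L) (hM : 0 < M) (hE : Even M) (v : Grid M) :
    gridNorm L v ^ 2 = L ^ 2 * ∑ p ∈ modes M, ‖coeff L v p‖ ^ 2 := by
  rw [gridNorm_sq, gridInner_self hL hM v subset_rfl (coeff L v)
    fun x => (interpolation hL hE v x).symm]

theorem symbol_nonneg (L : ℝ) (p : ℤ × ℤ) : 0 ≤ symbol L p := by
  unfold symbol
  positivity

theorem fracLap_inner_self {M : ℕ} {L : ℝ} (hL : 0 < L) (hM : 0 < M) (hE : Even M) (γ : ℝ)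
    (v : Grid M) : gridInner L (fracLap L γ v) (fracLap L γ v) =
      L ^ 2 * ∑ p ∈ (modes M).erase 0, symbol L p ^ (2 * γ) * ‖coeff L v p‖ ^ 2 := by
  rw [gridInner_self hL hM _ (erase_subset _ _)
    (fun p => ((symbol L p ^ γ : ℝ) : ℂ) * coeff L v p) fun x => fracLap_eq hL hE γ v x]
  congr 1
  refine sum_congr rfl fun p _ => ?_
  rw [norm_mul, mul_pow, Complex.norm_real, Real.norm_of_nonneg
    (Real.rpow_nonneg (symbol_nonneg L p) _), ← Real.rpow_mul_natCast (symbol_nonneg L p)]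
  congr 2
  push_cast
  ring

theorem gradNorm_sq {M : ℕ} {L : ℝ} (hL : 0 < L) (hM : 0 < M) (v : Grid M) :
    gradNorm L v ^ 2 = L ^ 2 * ∑ p ∈ modes M, symbol L p * ‖coeff L v p‖ ^ 2 := by
  rw [gradNorm, Real.sq_sqrt (by positivity), sum_add_distrib]
  simp only [derivX, derivY]
  rw [parseval hL hM subset_rfl (fun p => Complex.I * freq L * p.1 * coeff L v p),
    parseval hL hM subset_rfl (fun p => Complex.I * freq L * p.2 * coeff L v p), ← mul_add,
    ← mul_assoc, meshSize_sq_mul L hM, ← sum_add_distrib]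
  congr 1
  refine sum_congr rfl fun p _ => ?_
  simp only [norm_mul, Complex.norm_I, Complex.norm_real, Complex.norm_intCast, mul_pow,
    Real.norm_eq_abs, sq_abs, symbol]
  ring

/-! ### The discrete Sobolev embedding -/

/-- The representative in `modes M` of a frequency modulo `M`. -/
def redMode (M : ℕ) (p : ℤ × ℤ) : ℤ × ℤ :=
  ((p.1 + M / 2) % M - M / 2, (p.2 + M / 2) % M - M / 2)

theorem redMode_mem {M : ℕ} (hM : 0 < M) (hE : Even M) (p : ℤ × ℤ) : redMode M p ∈ modes M := by
  obtain ⟨K, hK⟩ := hE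
  have hM' : (0 : ℤ) < M := by exact_mod_cast hM
  have h1 := Int.emod_nonneg (p.1 + M / 2) hM'.ne'
  have h2 := Int.emod_lt_of_pos (p.1 + M / 2) hM'
  have h3 := Int.emod_nonneg (p.2 + M / 2) hM'.ne'
  have h4 := Int.emod_lt_of_pos (p.2 + M / 2) hM'
  rw [mem_modes]
  simp only [redMode]
  generalize (p.1 + M / 2) % (M : ℤ) = a at *
  generalize (p.2 + M / 2) % (M : ℤ) = b at *
  omega

theorem wave_redMode {M : ℕ} {L : ℝ} (hL : 0 < L) (p : ℤ × ℤ) (x : Fin M × Fin M) :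
    wave L (redMode M p) x = wave L p x := by
  have h : ∀ a : ℤ, (M : ℤ) ∣ (a + M / 2) % M - M / 2 - a := fun a => by
    rw [Int.emod_def]
    exact ⟨-((a + M / 2) / M), by ring⟩
  exact wave_congr hL _ _ x (h p.1) (h p.2)

/-- Distinct modes are incongruent modulo `M`. Hence, despite aliasing, the total frequency and two
summands determine the third. -/
theorem redMode_add_inj {M : ℕ} {p q r : ℤ × ℤ} (hp : p ∈ modes M) (hq : q ∈ modes M)
    (h : redMode M (r + p) = redMode M (r + q)) : p = q := by
  rw [mem_modes] at hp hq
  have key : ∀ a b c : ℤ, (c + a + M / 2) % M - M / 2 = (c + b + M / 2) % M - (M : ℤ) / 2 →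
      |a - b| < M → a = b := by
    intro a b c h hab
    have h1 : (M : ℤ) ∣ a - b := by
      have := Int.ModEq.dvd (show c + b + M / 2 ≡ c + a + M / 2 [ZMOD M] from by
        unfold Int.ModEq; omega)
      rwa [show c + a + (M : ℤ) / 2 - (c + b + M / 2) = a - b by ring] at this
    have := Int.eq_zero_of_abs_lt_dvd h1 hab
    omega
  simp only [redMode, Prod.mk.injEq, Prod.fst_add, Prod.snd_add] at h
  exact Prod.ext (key _ _ _ h.1 (by rw [abs_lt]; omega)) (key _ _ _ h.2 (by rw [abs_lt]; omega))

theorem wave_add {M : ℕ} {L : ℝ} (p q : ℤ × ℤ) (x : Fin M × Fin M) :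
    wave L (p + q) x = wave L p x * wave L q x := by
  rw [wave, wave, wave, ← Complex.exp_add]
  congr 1
  simp
  ring

/-- Frequencies add under multiplication of waves, and the grid sees them only modulo `M`, so the
triples are grouped by their reduced sum. -/
theorem cube_expansion {M : ℕ} {L : ℝ} (hL : 0 < L) (hM : 0 < M) (hE : Even M) (v : Grid M)
    (x : Fin M × Fin M) : (v x : ℂ) ^ 3 = ∑ k ∈ modes M,
      (∑ t ∈ modes M ×ˢ modes M ×ˢ modes M with redMode M (t.1 + t.2.1 + t.2.2) = k,
        coeff L v t.1 * (coeff L v t.2.1 * coeff L v t.2.2)) * wave L k x := by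
  have e : ∀ k ∈ modes M,
      (∑ t ∈ modes M ×ˢ modes M ×ˢ modes M with redMode M (t.1 + t.2.1 + t.2.2) = k,
        coeff L v t.1 * (coeff L v t.2.1 * coeff L v t.2.2)) * wave L k x =
      ∑ t ∈ modes M ×ˢ modes M ×ˢ modes M with redMode M (t.1 + t.2.1 + t.2.2) = k,
        coeff L v t.1 * wave L t.1 x *
          (coeff L v t.2.1 * wave L t.2.1 x * (coeff L v t.2.2 * wave L t.2.2 x)) := by
    intro k _
    rw [sum_mul]
    refine sum_congr rfl fun t ht => ?_
    rw [← (mem_filter.1 ht).2, wave_redMode hL, wave_add, wave_add]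
    ring
  rw [sum_congr rfl e, sum_fiberwise_of_maps_to fun t _ => redMode_mem hM hE _, sum_product]
  simp only [sum_product, ← mul_sum, ← sum_mul, interpolation hL hE v x]
  ring

/-- A weighted form of Young's convolution inequality for threefold convolutions. -/
theorem triple_convolution_le {ι κ : Type*} [DecidableEq κ] (S : Finset ι) (K : Finset κ)
    (σ : ι × ι × ι → κ) (hσ : ∀ t ∈ S ×ˢ S ×ˢ S, σ t ∈ K)
    (h₁ : ∀ p ∈ S, ∀ q ∈ S, ∀ r ∈ S, ∀ s ∈ S, σ (p, q, r) = σ (p, q, s) → r = s)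
    (h₂ : ∀ p ∈ S, ∀ q ∈ S, ∀ r ∈ S, ∀ s ∈ S, σ (p, r, q) = σ (p, s, q) → r = s)
    (h₃ : ∀ p ∈ S, ∀ q ∈ S, ∀ r ∈ S, ∀ s ∈ S, σ (r, p, q) = σ (s, p, q) → r = s)
    (c : ι → ℂ) (X a : ι → ℝ) (hX : ∀ p, 0 ≤ X p) (hc : ∀ p ∈ S, ‖c p‖ = X p * a p) :
    ∑ k ∈ K, ‖∑ t ∈ S ×ˢ S ×ˢ S with σ t = k, c t.1 * (c t.2.1 * c t.2.2)‖ ^ 2 ≤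
      (∑ p ∈ S, X p ^ 3) ^ 2 * (∑ p ∈ S, a p ^ 2) ^ 3 := by
  set T := S ×ˢ S ×ˢ S with hT
  -- A fibre of `σ` projects injectively to any two of its three indices, so the sum over it is part
  -- of a full double sum.
  have hproj : ∀ (k : κ) (f : ι × ι × ι → ι × ι), (∀ t ∈ T, f t ∈ S ×ˢ S) →
      (Set.InjOn f ({t ∈ T | σ t = k} : Finset _)) →
      ∑ t ∈ T with σ t = k, X (f t).1 ^ 3 * X (f t).2 ^ 3 ≤ (∑ p ∈ S, X p ^ 3) ^ 2 := by
    intro k f hf hinj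
    classical
    rw [← sum_image (f := fun y : ι × ι => X y.1 ^ 3 * X y.2 ^ 3) hinj, sq, sum_mul_sum,
      ← sum_product']
    refine sum_le_sum_of_subset_of_nonneg ?_ fun y _ _ =>
      mul_nonneg (pow_nonneg (hX _) _) (pow_nonneg (hX _) _)
    intro y hy
    obtain ⟨t, ht, rfl⟩ := mem_image.1 hy
    exact hf t (mem_filter.1 ht).1
  have hXXX : ∀ k, ∑ t ∈ T with σ t = k, (X t.1 * (X t.2.1 * X t.2.2)) ^ 2 ≤
      (∑ p ∈ S, X p ^ 3) ^ 2 := by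
    intro k
    have b1 := hproj k (fun t => (t.1, t.2.1)) (by
      rintro ⟨p, q, r⟩ ht
      simp only [hT, mem_product] at ht ⊢
      exact ⟨ht.1, ht.2.1⟩) (by
      rintro ⟨p, q, r⟩ ht ⟨p', q', r'⟩ ht' he
      simp only [coe_filter, hT, mem_product, Set.mem_ofPred_eq, Prod.mk.injEq] at ht ht' he
      obtain ⟨rfl, rfl⟩ := he
      rw [h₁ p ht.1.1 q ht.1.2.1 r ht.1.2.2 r' ht'.1.2.2 (ht.2.trans ht'.2.symm)])
    have b2 := hproj k (fun t => (t.1, t.2.2)) (by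
      rintro ⟨p, q, r⟩ ht
      simp only [hT, mem_product] at ht ⊢
      exact ⟨ht.1, ht.2.2⟩) (by
      rintro ⟨p, q, r⟩ ht ⟨p', q', r'⟩ ht' he
      simp only [coe_filter, hT, mem_product, Set.mem_ofPred_eq, Prod.mk.injEq] at ht ht' he
      obtain ⟨rfl, rfl⟩ := he
      rw [h₂ p ht.1.1 r ht.1.2.2 q ht.1.2.1 q' ht'.1.2.1 (ht.2.trans ht'.2.symm)])
    have b3 := hproj k (fun t => (t.2.1, t.2.2)) (by
      rintro ⟨p, q, r⟩ ht
      simp only [hT, mem_product] at ht ⊢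
      exact ht.2) (by
      rintro ⟨p, q, r⟩ ht ⟨p', q', r'⟩ ht' he
      simp only [coe_filter, hT, mem_product, Set.mem_ofPred_eq, Prod.mk.injEq] at ht ht' he
      obtain ⟨rfl, rfl⟩ := he
      rw [h₃ q ht.1.2.1 r ht.1.2.2 p ht.1.1 p' ht'.1.1 (ht.2.trans ht'.2.symm)])
    -- AM-GM trades three squares for two cubes. For `X p = ‖p‖⁻¹` on `ℤ²` this matters: the sum of
    -- squares diverges logarithmically, the sum of cubes converges.
    have am : ∀ t : ι × ι × ι, 3 * (X t.1 * (X t.2.1 * X t.2.2)) ^ 2 ≤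
        X t.1 ^ 3 * X t.2.1 ^ 3 + X t.1 ^ 3 * X t.2.2 ^ 3 + X t.2.1 ^ 3 * X t.2.2 ^ 3 := by
      intro t
      have amgm : ∀ x y z : ℝ, 0 ≤ x → 0 ≤ y → 0 ≤ z →
          3 * (x * y * z) ≤ x ^ 3 + y ^ 3 + z ^ 3 := by
        intro x y z hx hy hz
        nlinarith [mul_nonneg (add_nonneg (add_nonneg hx hy) hz)
          (add_nonneg (add_nonneg (sq_nonneg (x - y)) (sq_nonneg (y - z))) (sq_nonneg (z - x)))]
      have := amgm (X t.1 * X t.2.1) (X t.1 * X t.2.2) (X t.2.1 * X t.2.2)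
        (mul_nonneg (hX _) (hX _)) (mul_nonneg (hX _) (hX _)) (mul_nonneg (hX _) (hX _))
      simp only [mul_pow] at this ⊢
      linarith
    have := sum_le_sum fun t (_ : t ∈ {t ∈ T | σ t = k}) => am t
    rw [← mul_sum, sum_add_distrib, sum_add_distrib] at this
    linarith
  calc _ ≤ ∑ k ∈ K, (∑ p ∈ S, X p ^ 3) ^ 2 *
        ∑ t ∈ T with σ t = k, (a t.1 * (a t.2.1 * a t.2.2)) ^ 2 := by
        refine sum_le_sum fun k _ => ?_
        refine le_trans ?_ (mul_le_mul_of_nonneg_right (hXXX k)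
          (sum_nonneg fun t _ => sq_nonneg _))
        refine le_trans ?_ (sum_mul_sq_le_sq_mul_sq _ _ _)
        refine pow_le_pow_left₀ (norm_nonneg _) ((norm_sum_le _ _).trans_eq ?_) 2
        refine sum_congr rfl fun t ht => ?_
        have ht := (mem_filter.1 ht).1
        simp only [hT, mem_product] at ht
        rw [norm_mul, norm_mul, hc _ ht.1, hc _ ht.2.1, hc _ ht.2.2]
        ring
    _ = _ := by
        rw [← mul_sum, sum_fiberwise_of_maps_to hσ, hT, sum_product]
        simp only [sum_product, mul_pow, ← mul_sum, ← sum_mul]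
        ring

theorem summable_norm_inv_cube : Summable fun p : ℤ × ℤ => ‖p‖⁻¹ ^ 3 := by
  have h := EisensteinSeries.summable_one_div_norm_rpow (k := 3) (by norm_num)
  rw [← (finTwoArrowEquiv ℤ).symm.summable_iff] at h
  refine h.congr fun p => ?_
  have e : ‖(finTwoArrowEquiv ℤ).symm p‖ = ‖p‖ := by
    rw [EisensteinSeries.norm_eq_max_natAbs, Prod.norm_def]
    simp [Int.norm_eq_abs, Nat.cast_natAbs]
  rw [Function.comp, e, Real.rpow_neg (norm_nonneg _), inv_pow]
  norm_cast

theorem norm_sq_le_symbol {L : ℝ} (hL : 0 < L) (p : ℤ × ℤ) : ‖p‖ ^ 2 ≤ L ^ 2 * symbol L p := by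
  have e : L ^ 2 * symbol L p = (2 * Real.pi) ^ 2 * ((p.1 : ℝ) ^ 2 + (p.2 : ℝ) ^ 2) := by
    rw [symbol, freq]
    field_simp
  have h1 : (1 : ℝ) ≤ (2 * Real.pi) ^ 2 := one_le_pow₀ (by linarith [Real.pi_gt_three])
  have h2 : ‖p‖ ^ 2 ≤ (p.1 : ℝ) ^ 2 + (p.2 : ℝ) ^ 2 := by
    rw [Prod.norm_def]
    rcases max_choice ‖p.1‖ ‖p.2‖ with h | h <;> rw [h, Int.norm_eq_abs, sq_abs] <;>
      nlinarith [sq_nonneg (p.1 : ℝ), sq_nonneg (p.2 : ℝ)]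
  rw [e]
  nlinarith [sq_nonneg ‖p‖]

theorem coeff_zero {M : ℕ} {L : ℝ} (hL : 0 < L) (hM : 0 < M) {v : Grid M} (hv : MeanZero L v) :
    coeff L v 0 = 0 := by
  have h0 : meshSize L M ^ 2 ≠ 0 := by
    have : (0 : ℝ) < M := by exact_mod_cast hM
    unfold meshSize
    positivity
  have h1 := (mul_eq_zero.1 (show meshSize L M ^ 2 * ∑ x, v x * 1 = 0 from hv)).resolve_left h0
  have h2 : ∑ x, (v x : ℂ) = 0 := by
    simp only [mul_one] at h1
    exact_mod_cast h1
  have hw : ∀ x : Fin M × Fin M, wave L 0 x = 1 := fun x => by simp [wave]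
  simp [coeff, hw, h2]

theorem sum_sixth_le {M : ℕ} {L : ℝ} (hL : 0 < L) (hM : 0 < M) (hE : Even M) {v : Grid M}
    (hv : MeanZero L v) : meshSize L M ^ 2 * ∑ x, v x ^ 6 ≤
      L ^ 2 * (∑' p : ℤ × ℤ, ‖p‖⁻¹ ^ 3) ^ 2 * gradNorm L v ^ 6 := by
  have e : ∀ x, v x ^ 6 = ‖(v x : ℂ) ^ 3‖ ^ 2 := fun x => by
    rw [norm_pow, ← pow_mul, Complex.norm_real, Real.norm_eq_abs]
    exact (Even.pow_abs ⟨3, rfl⟩ _).symm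
  simp only [e, cube_expansion hL hM hE v]
  rw [parseval hL hM subset_rfl, ← mul_assoc, meshSize_sq_mul L hM, mul_assoc]
  refine mul_le_mul_of_nonneg_left ?_ (sq_nonneg L)
  refine (triple_convolution_le (modes M) (modes M) (fun t => redMode M (t.1 + t.2.1 + t.2.2))
    (fun t _ => redMode_mem hM hE _) ?_ ?_ ?_ (coeff L v) (fun p => ‖p‖⁻¹)
    (fun p => ‖p‖ * ‖coeff L v p‖) (fun p => by positivity) ?_).trans ?_
  · intro p _ q _ r hr s hs h
    exact redMode_add_inj hr hs h
  · intro p _ q _ r hr s hs h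
    refine redMode_add_inj (r := p + q) hr hs ?_
    simpa only [add_right_comm p _ q] using h
  · intro p _ q _ r hr s hs h
    refine redMode_add_inj (r := p + q) hr hs ?_
    simpa only [add_assoc, add_comm _ (p + q)] using h
  · intro p _
    -- At `p = 0` the weight `‖p‖⁻¹` is `0`, and the factorization survives because the mean of `v`
    -- vanishes.
    by_cases hp : p = 0
    · simp [hp, coeff_zero hL hM hv]
    · rw [inv_mul_cancel_left₀ (norm_ne_zero_iff.2 hp)]
  · have h1 : ∑ p ∈ modes M, ‖p‖⁻¹ ^ 3 ≤ ∑' p : ℤ × ℤ, ‖p‖⁻¹ ^ 3 :=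
      summable_norm_inv_cube.sum_le_tsum _ fun p _ => by positivity
    have h2 : ∑ p ∈ modes M, (‖p‖ * ‖coeff L v p‖) ^ 2 ≤ gradNorm L v ^ 2 := by
      rw [gradNorm_sq hL hM, mul_sum]
      refine sum_le_sum fun p _ => ?_
      rw [mul_pow, ← mul_assoc]
      exact mul_le_mul_of_nonneg_right (norm_sq_le_symbol hL p) (sq_nonneg _)
    rw [show gradNorm L v ^ 6 = (gradNorm L v ^ 2) ^ 3 by ring]
    gcongr

theorem gradNorm_nonneg {M : ℕ} (L : ℝ) (v : Grid M) : 0 ≤ gradNorm L v := Real.sqrt_nonneg _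

theorem exists_isEmbeddingConst {L : ℝ} (hL : 0 < L) :
    ∃ cz : ℝ, ∀ M : ℕ, 0 < M → Even M → IsEmbeddingConst L M cz := by
  set C := ∑' p : ℤ × ℤ, ‖p‖⁻¹ ^ 3 with hC
  -- The summand `1` only makes positivity of the constant immediate.
  refine ⟨(L ^ 2 * C ^ 2 + 1) ^ (1 / 6 : ℝ), fun M hM hE => ⟨by positivity, fun v hv => ?_⟩⟩
  have h := sum_sixth_le hL hM hE hv
  have e : ∀ x, |v x| ^ (6 : ℝ) = v x ^ 6 := fun x => by
    rw [show (6 : ℝ) = ((6 : ℕ) : ℝ) by norm_num, Real.rpow_natCast, Even.pow_abs ⟨3, rfl⟩]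
  have hg := gradNorm_nonneg L v
  have e2 : gradNorm L v = (gradNorm L v ^ 6) ^ (1 / 6 : ℝ) := by
    rw [← Real.rpow_natCast, ← Real.rpow_mul hg]
    norm_num
  rw [lqNorm, e2, ← Real.mul_rpow (by positivity) (by positivity)]
  simp only [e]
  refine Real.rpow_le_rpow (mul_nonneg (sq_nonneg _) (sum_nonneg fun x _ =>
    Even.pow_nonneg ⟨3, rfl⟩ _)) (h.trans ?_) (by norm_num)
  gcongr
  linarith




/-! ### Hölder's inequality and interpolation between the fractional norms -/

theorem gridNorm_mul_sq_le {M : ℕ} (L : ℝ) (u v : Grid M) :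
    gridNorm L (u * v) ^ 2 ≤ (lqNorm L 3 u * lqNorm L 6 v) ^ 2 := by
  have hH : 0 ≤ meshSize L M ^ 2 := sq_nonneg _
  have hpq : Real.HolderConjugate (3 / 2) 3 := by
    rw [Real.holderConjugate_iff]
    norm_num
  have h := Real.inner_le_Lp_mul_Lq univ (fun x => u x ^ 2) (fun x => v x ^ 2) hpq
  have e1 : ∀ x, |u x ^ 2| ^ (3 / 2 : ℝ) = |u x| ^ (3 : ℝ) := fun x => by
    rw [abs_pow, ← Real.rpow_natCast_mul (abs_nonneg _)]
    norm_num
  have e2 : ∀ x, |v x ^ 2| ^ (3 : ℝ) = |v x| ^ (6 : ℝ) := fun x => by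
    rw [abs_pow, ← Real.rpow_natCast_mul (abs_nonneg _)]
    norm_num
  simp only [e1, e2] at h
  have s1 : 0 ≤ ∑ x, |u x| ^ (3 : ℝ) := sum_nonneg fun x _ => by positivity
  have s2 : 0 ≤ ∑ x, |v x| ^ (6 : ℝ) := sum_nonneg fun x _ => by positivity
  have e3 : ∑ x, (u * v) x * (u * v) x = ∑ x, u x ^ 2 * v x ^ 2 :=
    sum_congr rfl fun x _ => by rw [Pi.mul_apply]; ring
  have e4 : meshSize L M ^ 2 =
      (meshSize L M ^ 2) ^ (1 / (3 / 2) : ℝ) * (meshSize L M ^ 2) ^ (1 / 3 : ℝ) := by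
    rw [← Real.rpow_add_of_nonneg hH (by norm_num) (by norm_num)]
    norm_num
  rw [gridNorm_sq, gridInner, e3, lqNorm, lqNorm, mul_pow,
    ← Real.rpow_mul_natCast (mul_nonneg hH s1), ← Real.rpow_mul_natCast (mul_nonneg hH s2)]
  norm_num only [Nat.cast_ofNat] at h e4 ⊢
  rw [Real.mul_rpow hH s1, Real.mul_rpow hH s2, mul_mul_mul_comm, ← e4]
  exact mul_le_mul_of_nonneg_left h hH

theorem freq_sq_le_symbol (L : ℝ) {p : ℤ × ℤ} (hp : p ≠ 0) : freq L ^ 2 ≤ symbol L p := by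
  refine le_mul_of_one_le_right (sq_nonneg _) ?_
  have h : 1 ≤ p.1 ^ 2 + p.2 ^ 2 := by
    by_contra! h
    have h1 : p.1 ^ 2 = 0 := by nlinarith [sq_nonneg p.1, sq_nonneg p.2]
    have h2 : p.2 ^ 2 = 0 := by nlinarith [sq_nonneg p.1, sq_nonneg p.2]
    exact hp (Prod.ext (by simpa using h1) (by simpa using h2))
  exact_mod_cast h

theorem freq_pos {L : ℝ} (hL : 0 < L) : 0 < freq L := by
  unfold freq
  positivity

/-- Mode by mode, `λ^{2α} = λ^{α-1} λ^{1+α}`, and `λ^{α-1} ≤ ν^{2(α-1)}` because `λ ≥ ν²` off the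
zero mode and `α < 1`. This is the source of the factor `max 1 (ν^{α-1})`. -/
theorem fracLap_inner_self_le {M : ℕ} {L α : ℝ} (hL : 0 < L) (hM : 0 < M) (hE : Even M)
    (hα : α < 1) (v : Grid M) :
    gridInner L (fracLap L α v) (fracLap L α v) ≤ max 1 (freq L ^ (α - 1)) ^ 2 *
      gridInner L (fracLap L ((1 + α) / 2) v) (fracLap L ((1 + α) / 2) v) := by
  rw [fracLap_inner_self hL hM hE, fracLap_inner_self hL hM hE, mul_left_comm]
  refine mul_le_mul_of_nonneg_left ?_ (sq_nonneg L)
  rw [mul_sum]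
  refine sum_le_sum fun p hp => ?_
  rw [← mul_assoc]
  refine mul_le_mul_of_nonneg_right ?_ (sq_nonneg _)
  have hν := freq_pos hL
  have h0 : freq L ^ 2 ≤ symbol L p := freq_sq_le_symbol L (ne_of_mem_erase hp)
  have hpos : 0 < symbol L p := (pow_pos hν 2).trans_le h0
  have h1 : symbol L p ^ (α - 1) ≤ max 1 (freq L ^ (α - 1)) ^ 2 :=
    calc symbol L p ^ (α - 1) ≤ (freq L ^ 2) ^ (α - 1) :=
          Real.rpow_le_rpow_of_nonpos (pow_pos hν 2) h0 (by linarith)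
      _ = (freq L ^ (α - 1)) ^ 2 := by
          rw [← Real.rpow_natCast_mul hν.le, ← Real.rpow_mul_natCast hν.le, mul_comm]
      _ ≤ _ := pow_le_pow_left₀ (Real.rpow_nonneg hν.le _) (le_max_right _ _) 2
  rw [show 2 * α = (α - 1) + 2 * ((1 + α) / 2) by ring, Real.rpow_add hpos]
  exact mul_le_mul_of_nonneg_right h1 (Real.rpow_nonneg hpos.le _)

/-- Young's inequality for `x = (e x) · e⁻¹` with exponents `1 + α` and `(1 + α)/α`. -/
theorem le_young_rpow {x e α : ℝ} (hx : 0 ≤ x) (he : 0 < e) (hα : 0 < α) :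
    x ≤ e ^ (1 + α) / (1 + α) * x ^ (1 + α) + α / ((1 + α) * e ^ ((1 + α) / α)) := by
  have hpq : Real.HolderConjugate (1 + α) ((1 + α) / α) := by
    rw [Real.holderConjugate_iff]
    refine ⟨by linarith, ?_⟩
    field_simp
  have h := Real.young_inequality_of_nonneg (mul_nonneg he.le hx) (inv_nonneg.2 he.le) hpq
  rw [Real.mul_rpow he.le hx, Real.inv_rpow he.le] at h
  refine (le_of_eq ?_).trans (h.trans_eq ?_)
  · field_simp
  · field_simp

theorem gradNorm_sq_le {M : ℕ} {L α e : ℝ} (hL : 0 < L) (hM : 0 < M) (hE : Even M)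
    (hα : 0 < α) (he : 0 < e) (v : Grid M) :
    gradNorm L v ^ 2 ≤ e ^ (1 + α) / (1 + α) *
        gridInner L (fracLap L ((1 + α) / 2) v) (fracLap L ((1 + α) / 2) v) +
      α / ((1 + α) * e ^ ((1 + α) / α)) * gridNorm L v ^ 2 := by
  have h0 : symbol L 0 = 0 := by simp [symbol]
  rw [gradNorm_sq hL hM, fracLap_inner_self hL hM hE, gridNorm_sq_eq hL hM hE, mul_left_comm,
    mul_left_comm _ (L ^ 2), ← mul_add, mul_div_cancel₀ _ (two_ne_zero' ℝ)]
  refine mul_le_mul_of_nonneg_left ?_ (sq_nonneg L)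
  -- The zero mode can be restored since `0 ^ (1 + α) = 0`.
  rw [sum_erase _ (by rw [h0, Real.zero_rpow (by linarith), zero_mul]), mul_sum, mul_sum,
    ← sum_add_distrib]
  refine sum_le_sum fun p _ => ?_
  rw [← mul_assoc, ← add_mul]
  exact mul_le_mul_of_nonneg_right (le_young_rpow (symbol_nonneg L p) he hα) (sq_nonneg _)

/-! ### The embedding type convolution inequality -/

/-- The kernels act in time only, so the scalar DOC inequalities apply at each grid point and are
then summed. -/
theorem docSum_gridInner {M : ℕ} (τ : ℕ → ℝ) (n : ℕ) (L : ℝ) (y w : ℕ → Grid M) :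
    docSum τ n (fun j k => gridInner L (y j) (w k)) =
      meshSize L M ^ 2 * ∑ x, docSum τ n (fun j k => w k x * y j x) := by
  simp only [docSum, gridInner]
  rw [sum_comm, mul_sum]
  refine sum_congr rfl fun k _ => ?_
  rw [sum_comm, mul_sum]
  refine sum_congr rfl fun j _ => ?_
  simp only [mul_sum]
  exact sum_congr rfl fun x _ => by ring

theorem sum_gridNorm_sq {M : ℕ} (τ : ℕ → ℝ) (n : ℕ) (L : ℝ) (w : ℕ → Grid M) :
    ∑ k ∈ Icc 2 n, τ k * gridNorm L (w k) ^ 2 =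
      meshSize L M ^ 2 * ∑ x, ∑ k ∈ Icc 2 n, τ k * w k x ^ 2 := by
  simp only [gridNorm_sq, gridInner]
  rw [sum_comm, mul_sum]
  refine sum_congr rfl fun k _ => ?_
  simp only [mul_sum]
  exact sum_congr rfl fun x _ => by ring

theorem IsMesh.grid_lower {M : ℕ} (h : IsMesh rUser n τ) (hm : IsKernelBound n τ m₁ m₂ m₃)
    (L : ℝ) (w : ℕ → Grid M) :
    m₁ / m₂ * ∑ k ∈ Icc 2 n, τ k * gridNorm L (w k) ^ 2 ≤
      2 * docSum τ n (fun j k => gridInner L (w j) (w k)) := by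
  rw [sum_gridNorm_sq, docSum_gridInner, mul_left_comm, mul_left_comm 2]
  refine mul_le_mul_of_nonneg_left ?_ (sq_nonneg _)
  rw [mul_sum, mul_sum]
  exact sum_le_sum fun x _ => h.doc_lower hm fun k => w k x

theorem IsMesh.grid_young {M : ℕ} (h : IsMesh rUser n τ) (hm : IsKernelBound n τ m₁ m₂ m₃)
    (L : ℝ) (y w : ℕ → Grid M) {δ : ℝ} (hδ : 0 < δ) :
    docSum τ n (fun j k => gridInner L (y j) (w k)) ≤
      δ * ∑ k ∈ Icc 2 n, τ k * gridNorm L (y k) ^ 2 +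
        m₃ / (4 * m₁ * δ) * ∑ k ∈ Icc 2 n, τ k * gridNorm L (w k) ^ 2 := by
  rw [sum_gridNorm_sq, sum_gridNorm_sq, docSum_gridInner, mul_left_comm,
    mul_left_comm _ (meshSize L M ^ 2), ← mul_add]
  refine mul_le_mul_of_nonneg_left ?_ (sq_nonneg _)
  rw [mul_sum, mul_sum, ← sum_add_distrib]
  exact sum_le_sum fun x _ => h.doc_young hm (fun k => y k x) (fun k => w k x) hδ

theorem lqNorm_nonneg {M : ℕ} (L q : ℝ) (v : Grid M) : 0 ≤ lqNorm L q v :=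
  Real.rpow_nonneg (mul_nonneg (sq_nonneg _) (sum_nonneg fun x _ => by positivity)) _

theorem gridNorm_mul_sq_le_gradNorm {M : ℕ} {L cz cu : ℝ} (hcz : IsEmbeddingConst L M cz)
    {u v : Grid M} (hu : lqNorm L 3 u ≤ cu) (hv : MeanZero L v) :
    gridNorm L (u * v) ^ 2 ≤ cu ^ 2 * cz ^ 2 * gradNorm L v ^ 2 := by
  refine (gridNorm_mul_sq_le L u v).trans ?_
  rw [← mul_pow, ← mul_pow, mul_assoc]
  exact pow_le_pow_left₀ (mul_nonneg (lqNorm_nonneg _ _ _) (lqNorm_nonneg _ _ _))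
    (mul_le_mul hu (hcz.2 v hv) (lqNorm_nonneg _ _ _) ((lqNorm_nonneg _ _ _).trans hu)) 2

theorem IsMesh.embedding_convolution (h : IsMesh rUser n τ) (hm : IsKernelBound n τ m₁ m₂ m₃)
    {L : ℝ} {M : ℕ} (hL : 0 < L) (hM : 0 < M) (hE : Even M) {cz : ℝ}
    (hcz : IsEmbeddingConst L M cz) (u v : ℕ → Grid M) {cu : ℝ} (hcu : 0 < cu)
    (hv : ∀ k ∈ Icc 2 n, MeanZero L (v k)) (hu : ∀ k ∈ Icc 2 n, lqNorm L 3 (u k) ≤ cu)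
    {ε α : ℝ} (hε : 0 < ε) (hα₀ : 0 < α) (hα₁ : α < 1) :
    docSum τ n (fun j k => gridInner L (u j * v j) (-fracLap L α (v k))) ≤
      ε * docSum τ n (fun j k => gridInner L (fracLap L ((1 + α) / 2) (v j))
        (fracLap L ((1 + α) / 2) (v k))) +
      eta m₁ m₂ m₃ (max 1 (freq L ^ (α - 1)) * cz) cu α ε *
        ∑ k ∈ Icc 2 n, τ k * gridNorm L (v k) ^ 2 := by
  have h₁ := hm.pos₁
  have h₂ := hm.pos₂
  have h₃ := hm.pos₃
  have hz := hcz.1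
  set K := max 1 (freq L ^ (α - 1)) with hK
  have hK0 : 0 < K := lt_max_of_lt_left one_pos
  set e := eps₃ m₁ m₂ m₃ (K * cz) cu α ε with he
  have he0 : 0 < e := by rw [he, eps₃]; positivity
  have hepow : e ^ (1 + α) =
      ε ^ 2 * m₁ ^ 3 * (1 + α) / (4 * (K * cz) ^ 2 * cu ^ 2 * m₂ ^ 2 * m₃) := by
    rw [he, eps₃, one_div, Real.rpow_inv_rpow (by positivity) (by positivity)]
  set S : ℕ → ℝ := fun k => gridNorm L (fracLap L ((1 + α) / 2) (v k)) ^ 2 with hS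
  set D := docSum τ n (fun j k => gridInner L (fracLap L ((1 + α) / 2) (v j))
    (fracLap L ((1 + α) / 2) (v k))) with hD
  have hlow : m₁ / m₂ * ∑ k ∈ Icc 2 n, τ k * S k ≤ 2 * D :=
    h.grid_lower hm L fun k => fracLap L ((1 + α) / 2) (v k)
  -- This weight makes the `(-Δ_h)^α v` term equal to `ε/4 · m₁/m₂` times `∑ τ S` (`e2`). Then `ε₃`
  -- is what gives the gradient term the same coefficient (`e1`), and together they match `ε` times
  -- the DOC lower bound.
  set δ := m₂ * m₃ * K ^ 2 / (m₁ ^ 2 * ε) with hδ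
  have hδ0 : 0 < δ := by positivity
  have hyoung := h.grid_young hm L (fun k => u k * v k) (fun k => -fracLap L α (v k)) hδ0
  have hy : ∑ k ∈ Icc 2 n, τ k * gridNorm L (u k * v k) ^ 2 ≤
      cu ^ 2 * cz ^ 2 * (e ^ (1 + α) / (1 + α) * ∑ k ∈ Icc 2 n, τ k * S k +
        α / ((1 + α) * e ^ ((1 + α) / α)) * ∑ k ∈ Icc 2 n, τ k * gridNorm L (v k) ^ 2) := by
    rw [mul_sum, mul_sum, ← sum_add_distrib, mul_sum]
    refine sum_le_sum fun k hk => ?_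
    have hg := gradNorm_sq_le hL hM hE hα₀ he0 (v k)
    rw [← gridNorm_sq] at hg
    have := mul_le_mul_of_nonneg_left ((gridNorm_mul_sq_le_gradNorm hcz (hu k hk)
      (hv k hk)).trans (mul_le_mul_of_nonneg_left hg (by positivity))) (h.pos' hk).le
    refine this.trans_eq ?_
    simp only [hS]
    ring
  have hw : ∑ k ∈ Icc 2 n, τ k * gridNorm L (-fracLap L α (v k)) ^ 2 ≤
      K ^ 2 * ∑ k ∈ Icc 2 n, τ k * S k := by
    rw [mul_sum]
    refine sum_le_sum fun k hk => ?_
    have hf := fracLap_inner_self_le hL hM hE hα₁ (v k)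
    rw [← gridNorm_sq L (fracLap L ((1 + α) / 2) (v k))] at hf
    have hneg : gridNorm L (-fracLap L α (v k)) ^ 2 =
        gridInner L (fracLap L α (v k)) (fracLap L α (v k)) := by
      rw [gridNorm_sq]
      simp [gridInner]
    rw [hneg, mul_left_comm]
    exact mul_le_mul_of_nonneg_left hf (h.pos' hk).le
  have e1 : δ * (cu ^ 2 * cz ^ 2 * (e ^ (1 + α) / (1 + α))) = ε / 4 * (m₁ / m₂) := by
    rw [hδ, hepow]
    field_simp
  have e2 : m₃ / (4 * m₁ * δ) * K ^ 2 = ε / 4 * (m₁ / m₂) := by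
    rw [hδ]
    field_simp
  have e3 : δ * (cu ^ 2 * cz ^ 2 * (α / ((1 + α) * e ^ ((1 + α) / α)))) =
      eta m₁ m₂ m₃ (K * cz) cu α ε := by
    rw [eta, ← he, hδ]
    field_simp
  calc _ ≤ _ := hyoung
    _ ≤ δ * (cu ^ 2 * cz ^ 2 * (e ^ (1 + α) / (1 + α) * ∑ k ∈ Icc 2 n, τ k * S k +
          α / ((1 + α) * e ^ ((1 + α) / α)) * ∑ k ∈ Icc 2 n, τ k * gridNorm L (v k) ^ 2)) +
        m₃ / (4 * m₁ * δ) * (K ^ 2 * ∑ k ∈ Icc 2 n, τ k * S k) :=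
      add_le_add (mul_le_mul_of_nonneg_left hy hδ0.le)
        (mul_le_mul_of_nonneg_left hw (by positivity))
    _ = ε / 2 * (m₁ / m₂ * ∑ k ∈ Icc 2 n, τ k * S k) +
        eta m₁ m₂ m₃ (K * cz) cu α ε * ∑ k ∈ Icc 2 n, τ k * gridNorm L (v k) ^ 2 := by
      rw [← e3]
      linear_combination (∑ k ∈ Icc 2 n, τ k * S k) * (e1 + e2)
    _ ≤ ε / 2 * (2 * D) + _ :=
      add_le_add (mul_le_mul_of_nonneg_left hlow (by positivity)) le_rfl
    _ = _ := by ring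

end FCH

theorem mainTheorem2 (rUser : ℝ) (hr₀ : 0 < rUser) (hr : rUser < 4.864) :
    -- the constants exist: `m₁, m₂, m₃` depend only on `rUser`, and `c_z` depends only on `L`
    (∃ m₁ m₂ m₃ : ℝ, ∀ (n : ℕ) (τ : ℕ → ℝ), FCH.IsMesh rUser n τ →
      FCH.IsKernelBound n τ m₁ m₂ m₃) ∧
    (∀ L : ℝ, 0 < L → ∃ cz : ℝ, ∀ M : ℕ, 0 < M → Even M → FCH.IsEmbeddingConst L M cz) ∧
    -- all such constants can be used
    ∀ (n : ℕ) (τ : ℕ → ℝ), FCH.IsMesh rUser n τ →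
    ∀ m₁ m₂ m₃ : ℝ, FCH.IsKernelBound n τ m₁ m₂ m₃ →
      -- the two-sided bound for the DOC quadratic form
      (∀ w : ℕ → ℝ,
        m₁ / m₂ * ∑ k ∈ Icc 2 n, τ k * w k ^ 2 ≤ 2 * FCH.docSum τ n (fun j k => w k * w j) ∧
        2 * FCH.docSum τ n (fun j k => w k * w j) ≤ m₃ * ∑ k ∈ Icc 2 n, τ k * w k ^ 2) ∧
      -- the Young-type convolution inequality
      (∀ (v w : ℕ → ℝ) (ε : ℝ), 0 < ε →
        FCH.docSum τ n (fun j k => w k * v j) ≤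
          ε * ∑ k ∈ Icc 2 n, τ k * v k ^ 2 +
            m₃ / (4 * m₁ * ε) * ∑ k ∈ Icc 2 n, τ k * w k ^ 2) ∧
      -- the embedding type convolution inequality; the constant `max 1 (ν ^ (α - 1)) * cz`
      -- is `cz` itself when `L ≤ 2π`
      ∀ (L : ℝ) (M : ℕ), 0 < L → 0 < M → Even M →
      ∀ cz : ℝ, FCH.IsEmbeddingConst L M cz →
      ∀ (u v : ℕ → FCH.Grid M) (cu : ℝ), 0 < cu →
        (∀ k ∈ Icc 2 n, FCH.MeanZero L (v k)) →
        (∀ k ∈ Icc 2 n, FCH.lqNorm L 3 (u k) ≤ cu) →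
      ∀ ε α : ℝ, 0 < ε → 0 < α → α < 1 →
        FCH.docSum τ n (fun j k => FCH.gridInner L (u j * v j) (-FCH.fracLap L α (v k))) ≤
          ε * FCH.docSum τ n (fun j k =>
            FCH.gridInner L (FCH.fracLap L ((1 + α) / 2) (v j))
              (FCH.fracLap L ((1 + α) / 2) (v k))) +
          FCH.eta m₁ m₂ m₃ (max 1 (FCH.freq L ^ (α - 1)) * cz) cu α ε *
            ∑ k ∈ Icc 2 n, τ k * FCH.gridNorm L (v k) ^ 2 := by
  refine ⟨FCH.exists_isKernelBound hr₀ hr, fun L hL => FCH.exists_isEmbeddingConst hL, ?_⟩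
  intro n τ h m₁ m₂ m₃ hm
  refine ⟨fun w => ⟨h.doc_lower hm w, hm.doc_upper w⟩,
    fun v w ε hε => h.doc_young hm v w hε, ?_⟩
  intro L M hL hM hE cz hcz u v cu hcu hv hu ε α hε hα₀ hα₁
  exact h.embedding_convolution hm hL hM hE hcz u v hcu hv hu hε hα₀ hα₁
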